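/- All logarithms are in base $2$. For $b\ge 1$ and $x\in\mathbb R$ let $[x]_b=\lfloor x\rfloor+\sum_{i=1}^b 2^{-i}a_i$, where $0.a_1a_2\ldots$ is the binary expansion of $x-\lfloor x\rfloor$ (that is, $[x]_b=2^{-b}\lfloor 2^bx\rfloor$). Let $\mathcal X\subset\mathbb R$ be a bounded set, $\mathcal X_b=\{[x]_b:x\in\mathcal X\}$, and let $\mathbf X=\{X_i\}_{i\ge1}$ be a stationary process with values in $\mathcal X$ that is $\Psi^*$-mixing, i.e. $\lim_{g\to\infty}\psi^*(g)=1$, where $\psi^*(g)$ is the supremum of $P(\mathcal A\cap\mathcal B)/(P(\mathcal A)P(\mathcal B))$ over all $j\ge 1$, $\mathcal A\in\sigma(X_i:i\le j)$ and $\mathcal B\in\sigma(X_i:i\ge j+g)$ with $P(\mathcal A)P(\mathcal B)>0$. Let $$\bar d_o(\mathbf X)=\lim_{k\to\infty}\ \limsup_{b\to\infty}\ \frac{H([X_{k+1}]_b\mid [X_1]_b,\dots,[X_k]_b)}{b}$$ be its upper information dimension. For $u^n\in\mathbb R^n$ and $a^L\in\mathbb R^L$, $L<n$, let $\hat p_L(a^L\mid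 u^n)=\frac1{n-L}\,|\{L+1\le i\le n:\ (u_{i-L},\dots,u_{i-1})=a^L\}|$, and let $\hat p_{k+1}(a_{k+1}\mid a^k)=\hat p_{k+1}(a^{k+1})/\sum_{c}\hat p_{k+1}(a^kc)$, read as $0$ if $a^k$ does not occur. For weights $\mathbf w=(w_a)_{a\in\mathcal X_b^{k+1}}$ in $[0,\infty]$ let $c_{\mathbf w}(u^n)=\sum_{a\in\mathcal X_b^{k+1}}w_a\,\hat p_{k+1}(a\mid u^n)$, with $\infty\cdot0=0$. Fix $r>1$, $\delta>0$ and $\epsilon_w>0$. Put $b=b_n=\lfloor r\log\log n\rfloor$ and $\lambda=\lambda_n=(\log n)^{2r}$, let $k=k_n\to\infty$ with $k_n=o(\log n/\log\log n)$, and let $$m=m_n\ \ge\ (1+\delta)\,\bigl(\bar d_o(\mathbf X)+3\epsilon_w\bigr)\,n .$$ Let $A=A_n\in\mathbb R^{m\times n}$ have i.i.d. $\mathcal N(0,1)$ entries and be independent of $X^n$, and let $Y^m=AX^n$. Let $\mathbf W^*_n=(W^*_a)_{a\in\mathcal X_b^{k+1}}$ be the weights $W^*_{a^{k+1}}=-\log\hat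 p_{k+1}(a_{k+1}\mid a^k)$, computed from $\hat p_{k+1}(\cdot\mid[X^n]_b)$, with $-\log 0=\infty$. Let $\mathbf W_n$ be (possibly random) weights in $[0,\infty]$ indexed by $\mathcal X_b^{k+1}$ such that $$P\Bigl(\tfrac1b\,\|\mathbf W_n-\mathbf W_n^*\|_\infty>\epsilon_w\Bigr)\longrightarrow 0\qquad(n\to\infty),$$ where, in the difference, $|\infty-\infty|=0$ and $|\infty-x|=\infty$ for $x<\infty$. Let $$\hat X^n\in\operatorname*{arg\,min}_{u^n\in\mathcal X_b^n}\Bigl[c_{\mathbf W_n}(u^n)+\frac{\lambda}{n^2}\|Au^n-Y^m\|_2^2\Bigr]$$ be any minimizer. Then $$\frac1{\sqrt n}\,\|X^n-\hat X^n\|_2\ \longrightarrow\ 0\quad\text{in probability as } n\to\infty .$$ -/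

import Mathlib

open MeasureTheory ProbabilityTheory Filter Topology Asymptotics
open scoped ENNReal Matrix

namespace CSens

noncomputable section

/-! ### Quantization -/

/-- The `i`-th binary digit (`i ≥ 1`) of the fractional part of `x`. -/
def binDigit (x : ℝ) (i : ℕ) : ℤ := ⌊(2 : ℝ) ^ i * Int.fract x⌋ % 2

/-- The `b`-bit quantized version `[x]_b = ⌊x⌋ + ∑_{i=1}^b 2^{-i} a_i` of `x`. -/
def quantize (b : ℕ) (x : ℝ) : ℝ :=
  (⌊x⌋ : ℝ) + ∑ i ∈ Finset.Icc 1 b, ((2 : ℝ) ^ i)⁻¹ * (binDigit x i : ℝ)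

theorem quantize_eq_floor (b : ℕ) (x : ℝ) :
    quantize b x = (⌊(2 : ℝ) ^ b * x⌋ : ℝ) / 2 ^ b := by
  have key : ∀ b : ℕ, ∑ i ∈ Finset.Icc 1 b, ((2 : ℝ) ^ i)⁻¹ * (binDigit x i : ℝ)
      = (⌊(2 : ℝ) ^ b * Int.fract x⌋ : ℝ) / 2 ^ b := by
    intro b
    induction b with
    | zero => simp
    | succ b ih =>
      rw [Finset.sum_Icc_succ_top (by omega), ih, binDigit]
      have h1 : ⌊(2 : ℝ) ^ b * Int.fract x⌋ = ⌊(2 : ℝ) ^ (b + 1) * Int.fract x⌋ / 2 := by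
        have h := Int.floor_div_natCast ((2 : ℝ) ^ (b + 1) * Int.fract x) 2
        rw [← Nat.cast_ofNat (R := ℤ), ← h]
        congr 1
        push_cast
        ring
      have h2 := Int.emod_add_mul_ediv ⌊(2 : ℝ) ^ (b + 1) * Int.fract x⌋ 2
      rw [← h1] at h2
      have h3 : ((⌊(2 : ℝ) ^ (b + 1) * Int.fract x⌋ : ℤ) : ℝ)
          = ((⌊(2 : ℝ) ^ (b + 1) * Int.fract x⌋ % 2 : ℤ) : ℝ)
            + 2 * ((⌊(2 : ℝ) ^ b * Int.fract x⌋ : ℤ) : ℝ) := by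
        exact_mod_cast h2.symm
      rw [h3]
      field_simp
      ring
  rw [quantize, key]
  have h4 : (2 : ℝ) ^ b * x = (2 : ℝ) ^ b * Int.fract x + (((2 : ℤ) ^ b * ⌊x⌋ : ℤ) : ℝ) := by
    push_cast
    rw [← mul_add, Int.fract_add_floor]
  rw [h4, Int.floor_add_intCast]
  push_cast
  field_simp
  ring

/-- The quantized alphabet `𝒳_b = {[x]_b : x ∈ 𝒳}`. -/
def quantizedSet (𝒳 : Set ℝ) (b : ℕ) : Set ℝ := quantize b '' 𝒳

/-- The set `𝒳_b^L` of strings of length `L` over the quantized alphabet. -/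
def blocks (𝒳 : Set ℝ) (b L : ℕ) : Set (Fin L → ℝ) := {a | ∀ i, a i ∈ quantizedSet 𝒳 b}

/-! ### Processes: stationarity, mixing, information dimension

A process `X_1, X_2, …` is written `X 0, X 1, …`. -/

section

variable {Ω : Type*} [MeasurableSpace Ω]

/-- The process and its shift have the same law. -/
def IsStationary (P : Measure Ω) (X : ℕ → Ω → ℝ) : Prop :=
  IdentDistrib (fun ω (i : ℕ) => X (i + 1) ω) (fun ω (i : ℕ) => X i ω) P P

/-- The σ-field of the events generated by the `X i` with `i ∈ I`. -/
abbrev sigmaField (X : ℕ → Ω → ℝ) (I : Set ℕ) : MeasurableSpace Ω :=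
  ⨆ i ∈ I, MeasurableSpace.comap (X i) inferInstance

/-- `ψ*(g)`: the supremum of `P(A ∩ B) / (P(A) P(B))` over all `j`, all `A` in the past up to `j`
and all `B` in the future from `j + g` on, with `P(A) P(B) > 0`. -/
def psiStar (P : Measure Ω) (X : ℕ → Ω → ℝ) (g : ℕ) : ℝ≥0∞ :=
  ⨆ (j : ℕ) (A : Set Ω) (B : Set Ω)
    (_ : MeasurableSet[sigmaField X (Set.Iic j)] A)
    (_ : MeasurableSet[sigmaField X (Set.Ici (j + g))] B)
    (_ : 0 < P A * P B), P (A ∩ B) / (P A * P B)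

/-- `Ψ*`-mixing processes. -/
def IsPsiStarMixing (P : Measure Ω) (X : ℕ → Ω → ℝ) : Prop :=
  Tendsto (psiStar P X) atTop (𝓝 1)

/-- Conditional entropy `H(V | U)`, in bits, of discrete random variables:
`∑ P(U = a, V = c) log (P(U = a) / P(U = a, V = c))`. All terms are non-negative. -/
def condEntropy {α β : Type*} (P : Measure Ω) (V : Ω → β) (U : Ω → α) : ℝ≥0∞ :=
  ∑' (a : α) (c : β), ENNReal.ofReal
    (P.real {ω | U ω = a ∧ V ω = c} *
      Real.logb 2 (P.real {ω | U ω = a} / P.real {ω | U ω = a ∧ V ω = c}))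

/-- The `k`-th order upper information dimension
`limsup_{b → ∞} H([X_{k+1}]_b | [X^k]_b) / b`. -/
def upperIDOrder (P : Measure Ω) (X : ℕ → Ω → ℝ) (k : ℕ) : ℝ≥0∞ :=
  limsup (fun b : ℕ =>
    condEntropy P (fun ω => quantize b (X k ω)) (fun ω (i : Fin k) => quantize b (X i ω))
      / (b : ℝ≥0∞)) atTop

/-- The upper information dimension of a process: the limit of `upperIDOrder P X k` as `k → ∞`
(the limsup is that limit whenever it exists, see `upperID_eq_of_tendsto`; for a stationary process
the sequence is non-increasing, so that the limit exists). -/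
def upperID (P : Measure Ω) (X : ℕ → Ω → ℝ) : ℝ≥0∞ := limsup (upperIDOrder P X) atTop

theorem upperID_eq_of_tendsto (P : Measure Ω) (X : ℕ → Ω → ℝ) (d : ℝ≥0∞)
    (h : Tendsto (upperIDOrder P X) atTop (𝓝 d)) : upperID P X = d := h.limsup_eq

end

/-! ### Empirical distributions and weights -/

/-- The `L`-th order empirical distribution of `u^n`,
`p̂_L(a^L | u^n) = #{i : u_{i-L}^{i-1} = a^L, L + 1 ≤ i ≤ n} / (n - L)`; the index `j = i - L - 1`
is the zero-based starting point of the window. -/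
def empDist {n : ℕ} (u : Fin n → ℝ) (L : ℕ) (a : Fin L → ℝ) : ℝ≥0∞ :=
  (Nat.card {j : Fin (n - L) // ∀ t : Fin L, u ⟨j + t, by omega⟩ = a t} : ℝ≥0∞)
    / ((n - L : ℕ) : ℝ≥0∞)

/-- The conditional empirical probability `p̂_{k+1}(a_{k+1} | a^k)` of `u^n`, that is
`p̂_{k+1}(a^{k+1})` divided by `∑_c p̂_{k+1}(a^k c)`. It is `0` if `a^k` does not occur. -/
def empCond {n : ℕ} (u : Fin n → ℝ) (k : ℕ) (a : Fin (k + 1) → ℝ) : ℝ≥0∞ :=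
  empDist u (k + 1) a / ∑' c : ℝ, empDist u (k + 1) (Function.update a (Fin.last k) c)

/-- `W*_a = - log p̂_{k+1}(a_{k+1} | a^k)`, with `- log 0 = ∞`. -/
def idealWeight {n : ℕ} (u : Fin n → ℝ) (k : ℕ) (a : Fin (k + 1) → ℝ) : ℝ≥0∞ :=
  if empCond u k a = 0 then ∞ else ENNReal.ofReal (-Real.logb 2 (empCond u k a).toReal)

/-- The `ℓ_∞` distance of two vectors of weights in `[0, ∞]` indexed by `S`. Subtraction in
`ℝ≥0∞` is truncated, `∞ - ∞ = 0` and `∞ - x = ∞` for `x < ∞`: the summand at `a` is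
`|w a - v a|` for finite weights, `0` if both are infinite and `∞` if exactly one is. -/
def weightDist {α : Type*} (S : Set α) (w v : α → ℝ≥0∞) : ℝ≥0∞ :=
  ⨆ a ∈ S, max (w a - v a) (v a - w a)

/-- `c_w(u^n) = ∑_{a ∈ 𝒳_b^{k+1}} w_a p̂_{k+1}(a | u^n)`, with `∞ · 0 = 0`. -/
def weightCost (𝒳 : Set ℝ) (b k : ℕ) (w : (Fin (k + 1) → ℝ) → ℝ≥0∞) {n : ℕ}
    (u : Fin n → ℝ) : ℝ≥0∞ :=
  ∑' a : blocks 𝒳 b (k + 1), w a * empDist u (k + 1) a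

/-- The A-MEP cost `c_w(u^n) + (lam / n²) ‖A u^n - y‖₂²`. -/
def amepCost (𝒳 : Set ℝ) (b k : ℕ) (w : (Fin (k + 1) → ℝ) → ℝ≥0∞) (lam : ℝ) {m n : ℕ}
    (A : Matrix (Fin m) (Fin n) ℝ) (y : Fin m → ℝ) (u : Fin n → ℝ) : ℝ≥0∞ :=
  weightCost 𝒳 b k w u
    + ENNReal.ofReal (lam / (n : ℝ) ^ 2 * ‖WithLp.toLp 2 (A *ᵥ u - y)‖ ^ 2)

/-- `x` is a minimizer of the A-MEP cost over `𝒳_b^n`. -/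
def IsAMEPSolution (𝒳 : Set ℝ) (b k : ℕ) (w : (Fin (k + 1) → ℝ) → ℝ≥0∞) (lam : ℝ) {m n : ℕ}
    (A : Matrix (Fin m) (Fin n) ℝ) (y : Fin m → ℝ) (x : Fin n → ℝ) : Prop :=
  x ∈ blocks 𝒳 b n ∧ ∀ u ∈ blocks 𝒳 b n, amepCost 𝒳 b k w lam A y x ≤ amepCost 𝒳 b k w lam A y u

/-- The quantization level `b_n = ⌊r log log n⌋` (logarithms in base 2). -/
def bitLevel (r : ℝ) (n : ℕ) : ℕ := ⌊r * Real.logb 2 (Real.logb 2 n)⌋₊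

/-- The regularization coefficient `λ_n = (log n)^{2r}` (logarithm in base 2). -/
def regCoeff (r : ℝ) (n : ℕ) : ℝ := Real.logb 2 n ^ (2 * r)

/-- The first `n` samples `X^n` of a process. -/
def samples {Ω : Type*} (X : ℕ → Ω → ℝ) (n : ℕ) (ω : Ω) : Fin n → ℝ := fun i => X i ω

end

end CSens

/-! Write `x` for the source block, `z` for its quantization, `d` for the information dimension and
`ε` for `εw`. The ideal weights turn `c_w(u)` into the code length per symbol, in bits, of `u` under
the empirical kernel of order `k` of `z`. The proof compares a minimizer with `z` itself, using
three facts that hold with high probability, besides the assumed closeness of the weights.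

(1) The ideal cost of `z` is at most `b (d + ε/2)` (`tendsto_measure_weightCost_samples`). By Gibbs'
inequality the empirical kernel codes `z` at least as well as any kernel does, in particular the
true conditional law of a fixed order `l`, smoothed by a uniform law. The latter code length is a
sum of bounded functions of windows, and `Ψ*`-mixing makes it concentrate around its mean by
Chebyshev.

(2) `A` does not stretch the quantization error: `‖A(z - x)‖² ≤ 8m‖z - x‖²`, by a Chernoff bound.

(3) `‖A(u - x)‖² ≥ τ m ‖u - x‖²` for every `u` of small ideal cost
(`measure_exists_normSq_mulVec_lt_le`). By Kraft's inequality there are at most about `2^(nB)`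
sequences of ideal cost at most `B`, and each violates the bound with probability at most
`(eτ)^(m/2)`. As `m` exceeds `(1 + δ)(d + 3ε) n`, the union bound survives with `τ = 2^(-2b/(1 +
δ/2))`.

By minimality and (1), (2), the cost of the minimizer is at most `b (d + 3ε/2) + 32m/n`. Its ideal
cost is then small enough for (3), and the quadratic part of the cost bounds its mean squared error
by `(b + 32)/(4^b τ)`, which tends to zero (`IsAMEPSolution.normSq_sub_div_le`,
`tendsto_errorBound`). -/

namespace CSens

/-! ### Gaussian measurements -/

section Gaussian

theorem integral_exp_mul_sq_gaussianReal {v : NNReal} (hv : v ≠ 0) {t : ℝ} (ht : 2 * t * v < 1) :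
    ∫ x, Real.exp (t * x ^ 2) ∂(gaussianReal 0 v) = √(1 / (1 - 2 * t * v)) := by
  have hv' : (0 : ℝ) < v := by positivity
  rw [integral_gaussianReal_eq_integral_smul hv]
  have h1 : ∀ x : ℝ, gaussianPDFReal 0 v x • Real.exp (t * x ^ 2)
      = (√(2 * Real.pi * v))⁻¹ * Real.exp (-(1 / (2 * v) - t) * x ^ 2) := by
    intro x
    rw [gaussianPDFReal_def, smul_eq_mul, mul_assoc, ← Real.exp_add]
    congr 2
    field_simp
    ring
  simp_rw [h1]
  rw [integral_const_mul, integral_gaussian, ← Real.sqrt_inv, ← Real.sqrt_mul (by positivity)]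
  congr 1
  have h2 : 1 - 2 * t * (v : ℝ) ≠ 0 := by linarith
  have h3 : 1 / (2 * (v : ℝ)) - t = (1 - 2 * t * v) / (2 * v) := by field_simp
  rw [h3]
  have := Real.pi_pos
  field_simp

variable {Ω : Type*} [MeasurableSpace Ω] {P : Measure Ω} {m n : ℕ}
  {A : Ω → Matrix (Fin m) (Fin n) ℝ}

theorem covariance_entries [IsProbabilityMeasure P]
    (hlaw : ∀ i j, HasLaw (fun ω => A ω i j) (gaussianReal 0 1) P)
    (hindep : iIndepFun (fun (p : Fin m × Fin n) ω => A ω p.1 p.2) P) (p q : Fin m × Fin n) :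
    cov[fun ω => A ω p.1 p.2, fun ω => A ω q.1 q.2; P] = if p = q then 1 else 0 := by
  have hL : ∀ p : Fin m × Fin n, MemLp (fun ω => A ω p.1 p.2) 2 P := fun p =>
    (hlaw p.1 p.2).hasGaussianLaw.memLp_two
  split_ifs with h
  · subst h
    rw [covariance_self (hlaw _ _).aemeasurable, (hlaw p.1 p.2).variance_eq]
    simp
  · exact (hindep.indepFun h).covariance_eq_zero (hL p) (hL q)

theorem hasGaussianLaw_mulVec
    (hlaw : ∀ i j, HasLaw (fun ω => A ω i j) (gaussianReal 0 1) P)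
    (hindep : iIndepFun (fun (p : Fin m × Fin n) ω => A ω p.1 p.2) P) (v : Fin n → ℝ) :
    HasGaussianLaw (fun ω => A ω *ᵥ v) P := by
  have h1 : HasGaussianLaw (fun ω (p : Fin m × Fin n) => A ω p.1 p.2) P :=
    iIndepFun.hasGaussianLaw (fun p => (hlaw p.1 p.2).hasGaussianLaw) hindep
  let T : ((Fin m × Fin n) → ℝ) →L[ℝ] (Fin m → ℝ) :=
    ContinuousLinearMap.pi fun i => ∑ j, v j • ContinuousLinearMap.proj (i, j)
  have h2 := h1.map_of_measurable T T.continuous.measurable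
  convert h2 using 2 with ω
  ext i
  simp [T, Matrix.mulVec, dotProduct, mul_comm]

theorem covariance_mulVec [IsProbabilityMeasure P]
    (hlaw : ∀ i j, HasLaw (fun ω => A ω i j) (gaussianReal 0 1) P)
    (hindep : iIndepFun (fun (p : Fin m × Fin n) ω => A ω p.1 p.2) P) (v : Fin n → ℝ)
    (i i' : Fin m) :
    cov[fun ω => (A ω *ᵥ v) i, fun ω => (A ω *ᵥ v) i'; P]
      = if i = i' then ∑ j, v j ^ 2 else 0 := by
  have hL : ∀ i j, MemLp (fun ω => A ω i j * v j) 2 P := fun i j =>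
    (hlaw i j).hasGaussianLaw.memLp_two.mul_const _
  simp only [Matrix.mulVec, dotProduct]
  rw [covariance_fun_sum_fun_sum (hL i) (hL i')]
  have h : ∀ j j', cov[fun ω => A ω i j * v j, fun ω => A ω i' j' * v j'; P]
      = if i = i' ∧ j = j' then v j * v j' else 0 := by
    intro j j'
    have := covariance_entries hlaw hindep (i, j) (i', j')
    simp only [Prod.mk.injEq] at this
    rw [covariance_mul_const_left, covariance_mul_const_right, this]
    split_ifs <;> ring
  simp_rw [h]
  split_ifs with hi
  · simp [hi, sq]
  · simp [hi]

theorem hasLaw_mulVec_apply [IsProbabilityMeasure P]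
    (hlaw : ∀ i j, HasLaw (fun ω => A ω i j) (gaussianReal 0 1) P)
    (hindep : iIndepFun (fun (p : Fin m × Fin n) ω => A ω p.1 p.2) P) (v : Fin n → ℝ) (i : Fin m) :
    HasLaw (fun ω => (A ω *ᵥ v) i) (gaussianReal 0 (∑ j, v j ^ 2).toNNReal) P := by
  have hG : HasGaussianLaw (fun ω => (A ω *ᵥ v) i) P :=
    (hasGaussianLaw_mulVec hlaw hindep v).eval i
  refine ⟨hG.aemeasurable, ?_⟩
  rw [hG.map_eq_gaussianReal, ← covariance_self hG.aemeasurable,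
    covariance_mulVec hlaw hindep v i i, if_pos rfl]
  congr 1
  simp only [Matrix.mulVec, dotProduct]
  rw [integral_finsetSum]
  · refine Finset.sum_eq_zero fun j _ => ?_
    rw [integral_mul_const, (hlaw i j).integral_eq]
    simp
  · exact fun j _ => ((hlaw i j).hasGaussianLaw.memLp_two.mul_const _).integrable (by norm_num)

/-- The coordinates are jointly Gaussian and uncorrelated, hence independent; so `‖A v‖²` is `‖v‖²`
times a chi-square variable with `m` degrees of freedom. -/
theorem iIndepFun_mulVec [IsProbabilityMeasure P]
    (hlaw : ∀ i j, HasLaw (fun ω => A ω i j) (gaussianReal 0 1) P)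
    (hindep : iIndepFun (fun (p : Fin m × Fin n) ω => A ω p.1 p.2) P) (v : Fin n → ℝ) :
    iIndepFun (fun i ω => (A ω *ᵥ v) i) P :=
  (hasGaussianLaw_mulVec hlaw hindep v).iIndepFun_of_covariance_eq_zero fun i i' h => by
    rw [covariance_mulVec hlaw hindep v i i', if_neg h]

theorem mgf_normSq_mulVec [IsProbabilityMeasure P]
    (hlaw : ∀ i j, HasLaw (fun ω => A ω i j) (gaussianReal 0 1) P)
    (hindep : iIndepFun (fun (p : Fin m × Fin n) ω => A ω p.1 p.2) P) {v : Fin n → ℝ}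
    (hv : 0 < ∑ j, v j ^ 2) {t : ℝ} (ht : 2 * t * ∑ j, v j ^ 2 < 1) :
    mgf (fun ω => ∑ i, (A ω *ᵥ v) i ^ 2) P t = √(1 / (1 - 2 * t * ∑ j, v j ^ 2)) ^ m := by
  have hind : iIndepFun (fun i ω => (A ω *ᵥ v) i ^ 2) P :=
    (iIndepFun_mulVec hlaw hindep v).comp (fun _ x => x ^ 2) (fun _ => by fun_prop)
  have hmeas : ∀ i, AEMeasurable (fun ω => (A ω *ᵥ v) i ^ 2) P := fun i =>
    (hasLaw_mulVec_apply hlaw hindep v i).aemeasurable.pow_const 2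
  have h1 := hind.mgf_sum₀ (t := t) hmeas Finset.univ
  have h2 : (fun ω => ∑ i, (A ω *ᵥ v) i ^ 2) = ∑ i, fun ω => (A ω *ᵥ v) i ^ 2 := by
    ext ω; simp
  rw [h2, h1]
  have h3 : ∀ i, mgf (fun ω => (A ω *ᵥ v) i ^ 2) P t = √(1 / (1 - 2 * t * ∑ j, v j ^ 2)) := by
    intro i
    have h4 := (hasLaw_mulVec_apply hlaw hindep v i).integral_comp
      (f := fun x => Real.exp (t * x ^ 2)) (by fun_prop)
    have hc : (((∑ j, v j ^ 2).toNNReal : NNReal) : ℝ) = ∑ j, v j ^ 2 := Real.coe_toNNReal _ hv.le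
    rw [integral_exp_mul_sq_gaussianReal (by simpa using hv) (by rwa [hc]), hc] at h4
    exact h4
  simp [h3]

theorem normSq_toLp {ι : Type*} [Fintype ι] (v : ι → ℝ) : ‖WithLp.toLp 2 v‖ ^ 2 = ∑ i, v i ^ 2 := by
  rw [EuclideanSpace.real_norm_sq_eq]

/-- Without integrability the moment generating function would take the default value `0`, but its
closed form is positive. -/
theorem integrable_exp_normSq_mulVec [IsProbabilityMeasure P]
    (hlaw : ∀ i j, HasLaw (fun ω => A ω i j) (gaussianReal 0 1) P)
    (hindep : iIndepFun (fun (p : Fin m × Fin n) ω => A ω p.1 p.2) P) {v : Fin n → ℝ}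
    (hv : 0 < ∑ j, v j ^ 2) {t : ℝ} (ht : 2 * t * ∑ j, v j ^ 2 < 1) :
    Integrable (fun ω => Real.exp (t * ∑ i, (A ω *ᵥ v) i ^ 2)) P := by
  by_contra h
  have h1 := mgf_undef h
  rw [mgf_normSq_mulVec hlaw hindep hv ht] at h1
  have h2 : 0 < 1 - 2 * t * ∑ j, v j ^ 2 := by linarith
  have : 0 < √(1 / (1 - 2 * t * ∑ j, v j ^ 2)) ^ m := by positivity
  exact this.ne' h1

/-- Lower tail of `‖A v‖²`. -/
theorem measureReal_normSq_mulVec_lt_le [IsProbabilityMeasure P]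
    (hlaw : ∀ i j, HasLaw (fun ω => A ω i j) (gaussianReal 0 1) P)
    (hindep : iIndepFun (fun (p : Fin m × Fin n) ω => A ω p.1 p.2) P) (v : Fin n → ℝ)
    {τ : ℝ} (hτ : 0 < τ) :
    P.real {ω | ‖WithLp.toLp 2 (A ω *ᵥ v)‖ ^ 2 < τ * m * ‖WithLp.toLp 2 v‖ ^ 2}
      ≤ √(Real.exp 1 * τ) ^ m := by
  simp_rw [normSq_toLp]
  rcases (Finset.sum_nonneg fun j (_ : j ∈ Finset.univ) => sq_nonneg (v j)).eq_or_lt with h0 | hv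
  · rw [← h0]
    have : {ω | ∑ i, (A ω *ᵥ v) i ^ 2 < τ * m * 0} = ∅ := by
      ext ω
      simp only [mul_zero, Set.mem_ofPred_eq, Set.mem_empty_iff_false, iff_false, not_lt]
      positivity
    rw [this]
    simp only [measureReal_empty]
    positivity
  set σ := ∑ j, v j ^ 2 with hσ
  -- Chernoff exponent `-1/(2τσ)`: nearly optimal for small `τ` and negative for every `τ > 0`. Each
  -- coordinate then contributes `√(e / (1 + 1/τ)) ≤ √(eτ)`.
  have ht : 2 * (-(1 / (2 * τ * σ))) * ∑ j, v j ^ 2 < 1 := by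
    rw [← hσ]
    have : 0 < 1 / (2 * τ * σ) := by positivity
    nlinarith
  have h := measure_le_le_exp_mul_mgf (μ := P) (X := fun ω => ∑ i, (A ω *ᵥ v) i ^ 2)
    (t := -(1 / (2 * τ * σ))) (τ * m * σ) (by rw [neg_nonpos]; positivity)
    (integrable_exp_normSq_mulVec hlaw hindep hv ht)
  rw [mgf_normSq_mulVec hlaw hindep hv ht] at h
  refine le_trans (measureReal_mono (Set.ofPred_subset_ofPred.2 fun ω hω => le_of_lt hω)
    (measure_ne_top _ _)) (h.trans ?_)
  have h1 : -(-(1 / (2 * τ * σ))) * (τ * m * σ) = m * (1 / 2) := by field_simp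
  have h2 : 1 / (1 - 2 * (-(1 / (2 * τ * σ))) * ∑ j, v j ^ 2) = 1 / (1 + 1 / τ) := by
    congr 1
    rw [← hσ]
    field_simp
    ring
  rw [h1, h2, Real.exp_nat_mul, ← mul_pow]
  gcongr
  rw [Real.exp_half, ← Real.sqrt_mul (Real.exp_pos 1).le]
  gcongr
  rw [div_le_iff₀ (by positivity)]
  have : τ * (1 + 1 / τ) = τ + 1 := by field_simp
  linarith

/-- Upper tail of `‖A v‖²`. -/
theorem measureReal_lt_normSq_mulVec_le [IsProbabilityMeasure P]
    (hlaw : ∀ i j, HasLaw (fun ω => A ω i j) (gaussianReal 0 1) P)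
    (hindep : iIndepFun (fun (p : Fin m × Fin n) ω => A ω p.1 p.2) P) (v : Fin n → ℝ) :
    P.real {ω | 8 * m * ‖WithLp.toLp 2 v‖ ^ 2 < ‖WithLp.toLp 2 (A ω *ᵥ v)‖ ^ 2}
      ≤ (1 / 2) ^ m := by
  simp_rw [normSq_toLp]
  rcases (Finset.sum_nonneg fun j (_ : j ∈ Finset.univ) => sq_nonneg (v j)).eq_or_lt with h0 | hv
  · have hz : v = 0 := by
      ext j
      have := (Finset.sum_eq_zero_iff_of_nonneg fun j _ => sq_nonneg (v j)).1 h0.symm j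
        (Finset.mem_univ j)
      simpa using this
    simp [hz]
  set σ := ∑ j, v j ^ 2 with hσ
  -- With `t = 1/(4σ)` each coordinate contributes `e⁻² √2`, which is at most `1/2`.
  have ht : 2 * (1 / (4 * σ)) * ∑ j, v j ^ 2 < 1 := by
    rw [← hσ]
    have : 2 * (1 / (4 * σ)) * σ = 1 / 2 := by field_simp; norm_num
    linarith
  have h := measure_ge_le_exp_mul_mgf (μ := P) (X := fun ω => ∑ i, (A ω *ᵥ v) i ^ 2)
    (t := 1 / (4 * σ)) (8 * m * σ) (by positivity)
    (integrable_exp_normSq_mulVec hlaw hindep hv ht)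
  rw [mgf_normSq_mulVec hlaw hindep hv ht] at h
  refine le_trans (measureReal_mono (Set.ofPred_subset_ofPred.2 fun ω hω => le_of_lt hω)
    (measure_ne_top _ _)) (h.trans ?_)
  have h1 : -(1 / (4 * σ)) * (8 * m * σ) = m * (-2) := by field_simp; ring
  have h2 : 1 / (1 - 2 * (1 / (4 * σ)) * ∑ j, v j ^ 2) = 2 := by
    rw [← hσ]; field_simp; norm_num
  rw [h1, h2, Real.exp_nat_mul, ← mul_pow]
  gcongr
  have h3 : Real.exp (-2) ≤ 1 / 4 := by
    rw [Real.exp_neg, ← one_div]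
    have : (4 : ℝ) ≤ Real.exp 2 := by
      have h5 : (2 : ℝ) ≤ Real.exp 1 := by linarith [Real.add_one_le_exp (1 : ℝ)]
      have h4 : Real.exp 2 = Real.exp 1 * Real.exp 1 := by rw [← Real.exp_add]; norm_num
      nlinarith
    gcongr
  have h4 : √2 ≤ 2 := by rw [Real.sqrt_le_left (by norm_num)]; norm_num
  nlinarith [Real.exp_pos (-2), Real.sqrt_nonneg 2]

end Gaussian

/-- For independent `U` and `V`, a bound on the probability of all sections of `T` is a bound on the
probability that `(U, V) ∈ T`. -/
theorem measure_mem_le_of_forall_section {Ω α β : Type*} [MeasurableSpace Ω] [MeasurableSpace α]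
    [MeasurableSpace β] {P : Measure Ω} [IsProbabilityMeasure P] {U : Ω → α} {V : Ω → β}
    (hU : AEMeasurable U P) (hV : AEMeasurable V P) (hUV : IndepFun U V P) {T : Set (α × β)}
    (hT : MeasurableSet T) {p : ℝ≥0∞} (hp : ∀ y, P {ω | (U ω, y) ∈ T} ≤ p) :
    P {ω | (U ω, V ω) ∈ T} ≤ p := by
  have : IsProbabilityMeasure (P.map V) := Measure.isProbabilityMeasure_map hV
  have : IsProbabilityMeasure (P.map U) := Measure.isProbabilityMeasure_map hU
  have h1 : P {ω | (U ω, V ω) ∈ T} = (P.map fun ω => (U ω, V ω)) T :=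
    (Measure.map_apply_of_aemeasurable (hU.prodMk hV) hT).symm
  rw [h1, hUV.map_prod_eq_prod_map_map hU hV, Measure.prod_apply_symm hT]
  calc ∫⁻ y, P.map U ((fun x => (x, y)) ⁻¹' T) ∂(P.map V) ≤ ∫⁻ _, p ∂(P.map V) := by
        refine lintegral_mono fun y => ?_
        rw [Measure.map_apply_of_aemeasurable hU (measurable_prodMk_right hT)]
        exact hp y
    _ = p := by simp

/-! ### Empirical distributions as window counts -/

section Windows

variable {n : ℕ}

/-- The window of length `L` of `u` that starts at `j`. -/
def window (u : Fin n → ℝ) (L : ℕ) (j : Fin (n - L)) : Fin L → ℝ := fun t => u ⟨j + t, by omega⟩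

open Classical in
/-- The number of windows of `u` equal to `a`. -/
noncomputable def windowCount (u : Fin n → ℝ) (L : ℕ) (a : Fin L → ℝ) : ℕ :=
  (Finset.univ.filter fun j => window u L j = a).card

open Classical in
/-- The number of windows of `u` of length `k + 1` whose first `k` entries are `s`. -/
noncomputable def contextCount (u : Fin n → ℝ) (k : ℕ) (s : Fin k → ℝ) : ℕ :=
  (Finset.univ.filter fun j => Fin.init (window u (k + 1) j) = s).card

/-- The conditional empirical probability as a real number. -/
noncomputable def condFreq (u : Fin n → ℝ) (k : ℕ) (a : Fin (k + 1) → ℝ) : ℝ :=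
  windowCount u (k + 1) a / contextCount u k (Fin.init a)

theorem empDist_eq_windowCount (u : Fin n → ℝ) (L : ℕ) (a : Fin L → ℝ) :
    empDist u L a = (windowCount u L a : ℝ≥0∞) / ((n - L : ℕ) : ℝ≥0∞) := by
  classical
  unfold empDist windowCount
  congr 2
  rw [Nat.card_eq_fintype_card, Fintype.card_subtype]
  congr 1
  ext j
  simp [window, funext_iff]

/-- Averaging over patterns is averaging over positions. Membership in the blocks ensures that the
pattern at every position is among those summed. -/
theorem weightCost_eq_sum {𝒳 : Set ℝ} {b k : ℕ} (w : (Fin (k + 1) → ℝ) → ℝ≥0∞) {u : Fin n → ℝ}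
    (hu : u ∈ blocks 𝒳 b n) :
    weightCost 𝒳 b k w u
      = (∑ j, w (window u (k + 1) j)) / ((n - (k + 1) : ℕ) : ℝ≥0∞) := by
  classical
  have hmem : ∀ j, window u (k + 1) j ∈ blocks 𝒳 b (k + 1) := fun j t => hu _
  have h1 : ∀ a : Fin (k + 1) → ℝ, w a * empDist u (k + 1) a
      = (∑ j, if window u (k + 1) j = a then w (window u (k + 1) j) else 0)
        / ((n - (k + 1) : ℕ) : ℝ≥0∞) := by
    intro a
    rw [empDist_eq_windowCount, ← mul_div_assoc, windowCount, Finset.card_filter]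
    congr 1
    push_cast
    rw [Finset.mul_sum]
    refine Finset.sum_congr rfl fun j _ => ?_
    split_ifs with h <;> simp [h]
  unfold weightCost
  simp_rw [h1, div_eq_mul_inv]
  rw [ENNReal.tsum_mul_right]
  congr 1
  rw [Summable.tsum_finsetSum fun _ _ => ENNReal.summable]
  refine Finset.sum_congr rfl fun j _ => ?_
  rw [tsum_eq_single ⟨window u (k + 1) j, hmem j⟩]
  · simp
  · rintro ⟨a, ha⟩ hne
    rw [if_neg]
    rintro rfl
    exact hne rfl

theorem tsum_windowCount_update (u : Fin n → ℝ) (k : ℕ) (a : Fin (k + 1) → ℝ) :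
    ∑' c : ℝ, (windowCount u (k + 1) (Function.update a (Fin.last k) c) : ℝ≥0∞)
      = contextCount u k (Fin.init a) := by
  classical
  unfold windowCount contextCount
  simp_rw [Finset.card_filter]
  push_cast
  rw [Summable.tsum_finsetSum fun _ _ => ENNReal.summable]
  refine Finset.sum_congr rfl fun j _ => ?_
  have h : ∀ c, window u (k + 1) j = Function.update a (Fin.last k) c
      ↔ Fin.init (window u (k + 1) j) = Fin.init a ∧ window u (k + 1) j (Fin.last k) = c := by
    intro c
    constructor
    · intro h
      rw [h]
      simp
    · rintro ⟨h1, rfl⟩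
      rw [← Fin.snoc_init_self (window u (k + 1) j), h1]
      ext t
      refine Fin.lastCases ?_ (fun t => ?_) t
      · simp
      · simp [Fin.init, (Fin.castSucc_lt_last t).ne]
  simp_rw [h]
  rw [tsum_eq_single (window u (k + 1) j (Fin.last k))]
  · simp
  · intro c hc
    rw [if_neg]
    exact fun h => hc h.2.symm

theorem windowCount_le_contextCount (u : Fin n → ℝ) (k : ℕ) (a : Fin (k + 1) → ℝ) :
    windowCount u (k + 1) a ≤ contextCount u k (Fin.init a) := by
  classical
  unfold windowCount contextCount
  refine Finset.card_le_card fun j hj => ?_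
  simp only [Finset.mem_filter, Finset.mem_univ, true_and] at hj ⊢
  rw [hj]

theorem condFreq_nonneg (u : Fin n → ℝ) (k : ℕ) (a : Fin (k + 1) → ℝ) : 0 ≤ condFreq u k a := by
  unfold condFreq; positivity

theorem condFreq_le_one (u : Fin n → ℝ) (k : ℕ) (a : Fin (k + 1) → ℝ) : condFreq u k a ≤ 1 :=
  div_le_one_of_le₀ (by exact_mod_cast windowCount_le_contextCount u k a) (by positivity)

theorem condFreq_window_pos (u : Fin n → ℝ) (k : ℕ) (j : Fin (n - (k + 1))) :
    0 < condFreq u k (window u (k + 1) j) := by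
  classical
  have h1 : 0 < windowCount u (k + 1) (window u (k + 1) j) :=
    Finset.card_pos.2 ⟨j, by simp⟩
  have h2 := h1.trans_le (windowCount_le_contextCount u k (window u (k + 1) j))
  unfold condFreq
  positivity

/-- The factors `n - (k + 1)` cancel. If the pattern does not occur, both sides are `0`, whatever
the denominators. -/
theorem empCond_eq_ofReal (u : Fin n → ℝ) (k : ℕ) (a : Fin (k + 1) → ℝ) :
    empCond u k a = ENNReal.ofReal (condFreq u k a) := by
  classical
  unfold empCond condFreq
  simp_rw [empDist_eq_windowCount, div_eq_mul_inv]
  rw [ENNReal.tsum_mul_right, tsum_windowCount_update]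
  rcases Nat.eq_zero_or_pos (windowCount u (k + 1) a) with h0 | h0
  · simp [h0]
  have h1 := windowCount_le_contextCount u k a
  have hN : 0 < n - (k + 1) := by
    obtain ⟨j, -⟩ := Finset.card_pos.1 h0
    exact j.pos
  rw [← div_eq_mul_inv, ← div_eq_mul_inv, ← div_eq_mul_inv (_ : ℝ≥0∞), ← div_eq_mul_inv (_ : ℝ),
    ENNReal.ofReal_div_of_pos (by exact_mod_cast h0.trans_le h1), ENNReal.ofReal_natCast,
    ENNReal.ofReal_natCast]
  rw [div_eq_mul_inv _ ((n - (k + 1) : ℕ) : ℝ≥0∞), div_eq_mul_inv _ ((n - (k + 1) : ℕ) : ℝ≥0∞),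
    ENNReal.mul_div_mul_right]
  · simp
  · simp only [ne_eq, ENNReal.inv_eq_top, Nat.cast_eq_zero]; omega

theorem idealWeight_eq (u : Fin n → ℝ) (k : ℕ) (a : Fin (k + 1) → ℝ) :
    idealWeight u k a = if condFreq u k a = 0 then ∞
      else ENNReal.ofReal (-Real.logb 2 (condFreq u k a)) := by
  unfold idealWeight
  rw [empCond_eq_ofReal, ENNReal.toReal_ofReal (condFreq_nonneg u k a)]
  have h : ENNReal.ofReal (condFreq u k a) = 0 ↔ condFreq u k a = 0 := by
    rw [ENNReal.ofReal_eq_zero]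
    exact ⟨fun h => le_antisymm h (condFreq_nonneg u k a), le_of_eq⟩
  simp only [h]

theorem sum_condFreq_snoc_le_one (u : Fin n → ℝ) (k : ℕ) (S : Finset ℝ) (s : Fin k → ℝ) :
    ∑ c ∈ S, condFreq u k (Fin.snoc s c) ≤ 1 := by
  classical
  unfold condFreq
  simp only [Fin.init_snoc]
  rw [← Finset.sum_div]
  refine div_le_one_of_le₀ ?_ (by positivity)
  norm_cast
  unfold windowCount contextCount
  rw [← Finset.card_biUnion]
  · refine Finset.card_le_card fun j hj => ?_
    simp only [Finset.mem_biUnion, Finset.mem_filter, Finset.mem_univ, true_and] at hj ⊢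
    obtain ⟨c, -, hc⟩ := hj
    rw [hc, Fin.init_snoc]
  · intro c _ c' _ hcc'
    refine Finset.disjoint_left.2 fun j hj hj' => hcc' ?_
    simp only [Finset.mem_filter, Finset.mem_univ, true_and] at hj hj'
    have := congrFun (hj.symm.trans hj') (Fin.last k)
    simpa using this

end Windows

/-! ### Gibbs' inequality and Kraft's inequality -/

open Classical in
/-- Gibbs' inequality for conditional empirical frequencies: the empirical kernel has the smallest
empirical code length. -/
theorem sum_neg_logb_freq_le {J S T : Type*} [Fintype J] (s : J → S) (t : J → T) (q : S → T → ℝ)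
    (hq : ∀ a c, 0 ≤ q a c) (hq' : ∀ j, 0 < q (s j) (t j)) (F : Finset T) (hF : ∀ j, t j ∈ F)
    (hsum : ∀ a, ∑ c ∈ F, q a c ≤ 1) :
    ∑ j, -Real.logb 2 (((Finset.univ.filter fun i => s i = s j ∧ t i = t j).card : ℝ)
        / (Finset.univ.filter fun i => s i = s j).card)
      ≤ ∑ j, -Real.logb 2 (q (s j) (t j)) := by
  set cnt : S → T → ℕ := fun a c => (Finset.univ.filter fun i => s i = a ∧ t i = c).card with hcnt
  set ctx : S → ℕ := fun a => (Finset.univ.filter fun i => s i = a).card with hctx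
  have hpos : ∀ j, 0 < cnt (s j) (t j) := fun j => Finset.card_pos.2 ⟨j, by simp⟩
  have hpos' : ∀ j, 0 < ctx (s j) := fun j => Finset.card_pos.2 ⟨j, by simp⟩
  have hl2 : 0 < Real.log 2 := Real.log_pos (by norm_num)
  -- By `log y ≤ y - 1` it is enough that the ratios of `q` to the empirical kernel average to at
  -- most one. Expanding the context count as a sum over indices `i` with the same context and
  -- exchanging the sums leaves, for each `i`, a sum of `q (s i) c` over occurring symbols `c`.
  have key : ∑ j, q (s j) (t j) * ctx (s j) / cnt (s j) (t j) ≤ ∑ _j : J, (1 : ℝ) := by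
    have h1 : ∀ j, q (s j) (t j) * ctx (s j) / cnt (s j) (t j)
        = ∑ i, if s i = s j then q (s i) (t j) / cnt (s i) (t j) else 0 := by
      intro j
      rw [← Finset.sum_filter, Finset.sum_congr rfl (g := fun _ => q (s j) (t j) / cnt (s j) (t j))]
      · rw [Finset.sum_const, nsmul_eq_mul]
        ring
      · intro i hi
        rw [(Finset.mem_filter.1 hi).2]
    simp_rw [h1]
    rw [Finset.sum_comm]
    refine Finset.sum_le_sum fun i _ => ?_
    refine le_trans ?_ (hsum (s i))
    rw [← Finset.sum_filter, ← Finset.sum_fiberwise_of_maps_to (g := t) (t := F) (fun j _ => hF j)]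
    refine Finset.sum_le_sum fun c _ => ?_
    rw [Finset.sum_congr rfl (g := fun _ => q (s i) c / cnt (s i) c)]
    · rw [Finset.sum_const, nsmul_eq_mul, Finset.filter_filter]
      have h2 : (Finset.univ.filter fun j => s i = s j ∧ t j = c).card = cnt (s i) c := by
        simp only [hcnt, eq_comm]
      rw [h2]
      rcases Nat.eq_zero_or_pos (cnt (s i) c) with h0 | h0
      · simp [h0, hq]
      · rw [mul_div_cancel₀ _ (by positivity)]
    · intro j hj
      rw [(Finset.mem_filter.1 hj).2]
  have h3 : ∀ j, Real.log (q (s j) (t j)) - Real.log (cnt (s j) (t j) / ctx (s j))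
      ≤ q (s j) (t j) * ctx (s j) / cnt (s j) (t j) - 1 := by
    intro j
    have := hpos j
    have := hpos' j
    have := hq' j
    rw [← Real.log_div (by positivity) (by positivity)]
    refine (Real.log_le_sub_one_of_pos (by positivity)).trans (le_of_eq ?_)
    field_simp
  have h4 := Finset.sum_le_sum fun j (_ : j ∈ Finset.univ) => h3 j
  rw [Finset.sum_sub_distrib, Finset.sum_sub_distrib] at h4
  simp only [Real.logb, ← neg_div]
  rw [← Finset.sum_div, ← Finset.sum_div]
  refine div_le_div_of_nonneg_right ?_ hl2.le
  rw [Finset.sum_neg_distrib, Finset.sum_neg_distrib]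
  linarith

theorem sum_piFinset_snoc {M : Type*} [AddCommMonoid M] (S : Finset ℝ) (n : ℕ)
    (f : (Fin (n + 1) → ℝ) → M) :
    ∑ u ∈ Fintype.piFinset (fun _ : Fin (n + 1) => S), f u
      = ∑ u ∈ Fintype.piFinset (fun _ : Fin n => S), ∑ c ∈ S, f (Fin.snoc u c) := by
  rw [← Finset.sum_product']
  refine Finset.sum_nbij' (fun u => (Fin.init u, u (Fin.last n))) (fun p => Fin.snoc p.1 p.2)
    ?_ ?_ ?_ ?_ ?_
  · intro u hu
    simp only [Fintype.mem_piFinset, Finset.mem_product] at hu ⊢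
    exact ⟨fun i => hu _, hu _⟩
  · rintro ⟨u, c⟩ hu
    simp only [Fintype.mem_piFinset, Finset.mem_product] at hu ⊢
    intro i
    refine Fin.lastCases ?_ (fun i => ?_) i
    · simpa using hu.2
    · simpa using hu.1 i
  · intro u _
    simp
  · rintro ⟨u, c⟩ _
    simp
  · intro u _
    simp

/-- Kraft's inequality for sequences of symbols coded by a kernel of order `k`. -/
theorem sum_prod_kernel_le (S : Finset ℝ) (k : ℕ) (q : (Fin (k + 1) → ℝ) → ℝ) (hq : ∀ a, 0 ≤ q a)
    (hsum : ∀ s : Fin k → ℝ, ∑ c ∈ S, q (Fin.snoc s c) ≤ 1) (n N : ℕ) (h : N + k ≤ n) :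
    ∑ u ∈ Fintype.piFinset (fun _ : Fin n => S),
        ∏ j : Fin N, q (fun t => u ⟨j + t, by omega⟩) ≤ (S.card : ℝ) ^ (n - N) := by
  induction n generalizing N with
  | zero =>
    obtain rfl : N = 0 := by omega
    simp
  | succ n ih =>
    rw [sum_piFinset_snoc]
    have hsn : ∀ (N : ℕ) (hN : N + k ≤ n) (u : Fin n → ℝ) (c : ℝ) (j : Fin N),
        (fun t : Fin (k + 1) => (Fin.snoc u c : Fin (n + 1) → ℝ) ⟨j + t, by omega⟩)
          = fun t : Fin (k + 1) => u ⟨j + t, by omega⟩ := by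
      intro N hN u c j
      ext t
      have : (j : ℕ) + t < n := by omega
      simp [Fin.snoc, this]
    by_cases hN : N + k ≤ n
    · simp_rw [hsn N hN]
      simp only [Finset.sum_const, nsmul_eq_mul]
      rw [← Finset.mul_sum, show n + 1 - N = (n - N) + 1 by omega, pow_succ']
      exact mul_le_mul_of_nonneg_left (ih N hN) (by positivity)
    · obtain hN' : N + k = n + 1 := by omega
      rcases N with _ | N
      · simp only [Finset.univ_eq_empty, Finset.prod_empty, Finset.sum_const, nsmul_eq_mul, mul_one,
          Fintype.card_piFinset, Finset.prod_const, Finset.card_univ, Fintype.card_fin]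
        push_cast
        rw [← pow_succ]
      · have h1 : N + k ≤ n := by omega
        rw [show n + 1 - (N + 1) = n - N by omega]
        refine le_trans (Finset.sum_le_sum fun u hu => ?_) (ih N h1)
        simp_rw [Fin.prod_univ_castSucc]
        have h2 : ∀ (c : ℝ), ∏ j : Fin N, q (fun t : Fin (k + 1) =>
              (Fin.snoc u c : Fin (n + 1) → ℝ) ⟨(j.castSucc : ℕ) + t, by simp; omega⟩)
            = ∏ j : Fin N, q (fun t : Fin (k + 1) => u ⟨j + t, by omega⟩) := fun c =>
          Finset.prod_congr rfl fun j _ => congrArg q (hsn N h1 u c j)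
        simp_rw [h2]
        rw [← Finset.mul_sum]
        refine mul_le_of_le_one_right (Finset.prod_nonneg fun j _ => hq _) ?_
        refine le_trans (le_of_eq (Finset.sum_congr rfl fun c _ => congrArg q ?_))
          (hsum fun t => u ⟨N + t, by omega⟩)
        ext t
        refine Fin.lastCases ?_ (fun t => ?_) t
        · have : ¬ N + k < n := by omega
          simp [Fin.snoc, this]
        · have : N + (t : ℕ) < n := by omega
          simp [Fin.snoc, this]

/-- The number of sequences with small cost for the ideal weights of `x`. -/
theorem card_weightCost_le {𝒳 : Set ℝ} {b n k : ℕ} {S : Finset ℝ} (hS : quantizedSet 𝒳 b = S)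
    (hk : k + 1 < n) (x : Fin n → ℝ) {B : ℝ} (hB : 0 ≤ B) (C : Finset (Fin n → ℝ))
    (hC : ∀ u ∈ C, u ∈ blocks 𝒳 b n ∧ weightCost 𝒳 b k (idealWeight x k) u ≤ ENNReal.ofReal B) :
    (C.card : ℝ) ≤ (S.card : ℝ) ^ (k + 1) * 2 ^ (n * B) := by
  classical
  set N := n - (k + 1) with hN
  have hN0 : 0 < N := by omega
  have hK := sum_prod_kernel_le S k (condFreq x k) (condFreq_nonneg x k)
    (sum_condFreq_snoc_le_one x k S) n N (by omega)
  -- There are `N = n - (k + 1)` windows, which miss the final symbol. So `k + 1` symbols are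
  -- uncoded: the `k` initial ones and the last.
  rw [show n - N = k + 1 by omega] at hK
  have hsub : C ⊆ Fintype.piFinset (fun _ : Fin n => S) := by
    intro u hu
    rw [Fintype.mem_piFinset]
    intro i
    have := (hC u hu).1 i
    rw [hS] at this
    exact this
  have h1 : ∀ u ∈ C, (2 : ℝ) ^ (-(n * B)) ≤ ∏ j : Fin N, condFreq x k (window u (k + 1) j) := by
    intro u hu
    have h2 := (hC u hu).2
    rw [weightCost_eq_sum _ (hC u hu).1, ENNReal.div_le_iff (by exact_mod_cast hN0.ne') (by simp),
      ← ENNReal.ofReal_natCast, ← ENNReal.ofReal_mul hB] at h2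
    -- A sequence of finite cost contains no pattern of infinite weight.
    have hne : ∀ j, condFreq x k (window u (k + 1) j) ≠ 0 := by
      intro j h0
      have h3 : idealWeight x k (window u (k + 1) j) ≤ ENNReal.ofReal (B * N) :=
        (Finset.single_le_sum (f := fun j => idealWeight x k (window u (k + 1) j))
          (fun _ _ => zero_le) (Finset.mem_univ j)).trans h2
      rw [idealWeight_eq, if_pos h0] at h3
      simp at h3
    have hpos : ∀ j, 0 < condFreq x k (window u (k + 1) j) := fun j =>
      lt_of_le_of_ne (condFreq_nonneg _ _ _) (hne j).symm
    have hlog : ∀ j, 0 ≤ -Real.logb 2 (condFreq x k (window u (k + 1) j)) := fun j =>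
      neg_nonneg.2 (Real.logb_nonpos (by norm_num) (hpos j).le (condFreq_le_one _ _ _))
    simp_rw [idealWeight_eq, if_neg (hne _)] at h2
    rw [← ENNReal.ofReal_sum_of_nonneg fun j _ => hlog j,
      ENNReal.ofReal_le_ofReal_iff (by positivity), Finset.sum_neg_distrib] at h2
    have h4 : ∏ j : Fin N, condFreq x k (window u (k + 1) j)
        = 2 ^ (∑ j, Real.logb 2 (condFreq x k (window u (k + 1) j))) := by
      rw [Real.rpow_sum_of_pos (by norm_num)]
      refine Finset.prod_congr rfl fun j _ => ?_
      rw [Real.rpow_logb (by norm_num) (by norm_num) (hpos j)]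
    rw [h4]
    refine Real.rpow_le_rpow_of_exponent_le (by norm_num) ?_
    have h5 : B * N ≤ n * B := by
      rw [mul_comm]
      gcongr
      omega
    linarith
  have h2 : (C.card : ℝ) * 2 ^ (-(n * B)) ≤ (S.card : ℝ) ^ (k + 1) := by
    refine le_trans ?_ hK
    rw [← nsmul_eq_mul]
    refine (Finset.card_nsmul_le_sum C _ _ h1).trans ?_
    exact Finset.sum_le_sum_of_subset_of_nonneg hsub fun u _ _ =>
      Finset.prod_nonneg fun j _ => condFreq_nonneg _ _ _
  rw [Real.rpow_neg (by norm_num), ← div_eq_mul_inv, div_le_iff₀ (by positivity)] at h2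
  exact h2

/-- The ideal weights of `x` give `x` at most the cost of any kernel code. -/
theorem weightCost_idealWeight_le {𝒳 : Set ℝ} {b n k : ℕ} {S : Finset ℝ}
    (hS : quantizedSet 𝒳 b = S) {x : Fin n → ℝ} (hx : x ∈ blocks 𝒳 b n)
    (q : (Fin k → ℝ) → ℝ → ℝ) (hq : ∀ a c, 0 ≤ q a c) (hq' : ∀ a, ∀ c ∈ S, 0 < q a c)
    (hsum : ∀ a, ∑ c ∈ S, q a c ≤ 1) :
    weightCost 𝒳 b k (idealWeight x k) x ≤ ENNReal.ofReal
      ((∑ j, -Real.logb 2 (q (Fin.init (window x (k + 1) j)) (window x (k + 1) j (Fin.last k))))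
        / (n - (k + 1) : ℕ)) := by
  classical
  have hF : ∀ j, window x (k + 1) j (Fin.last k) ∈ S := by
    intro j
    have : window x (k + 1) j (Fin.last k) ∈ quantizedSet 𝒳 b := hx _
    rw [hS] at this
    exact this
  have h := sum_neg_logb_freq_le (fun j => Fin.init (window x (k + 1) j))
    (fun j => window x (k + 1) j (Fin.last k)) q hq (fun j => hq' _ _ (hF j)) S hF hsum
  have h1 : ∀ j, ((Finset.univ.filter fun i => Fin.init (window x (k + 1) i)
        = Fin.init (window x (k + 1) j) ∧ window x (k + 1) i (Fin.last k)
        = window x (k + 1) j (Fin.last k)).card : ℝ) / (Finset.univ.filter fun i =>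
          Fin.init (window x (k + 1) i) = Fin.init (window x (k + 1) j)).card
      = condFreq x k (window x (k + 1) j) := by
    intro j
    unfold condFreq windowCount contextCount
    congr 3
    ext i
    simp only [Finset.mem_filter, Finset.mem_univ, true_and]
    constructor
    · rintro ⟨h1, h2⟩
      rw [← Fin.snoc_init_self (window x (k + 1) i), h1, h2, Fin.snoc_init_self]
    · intro h
      rw [h]
      exact ⟨rfl, rfl⟩
  replace h : ∑ j, -Real.logb 2 (condFreq x k (window x (k + 1) j))
      ≤ ∑ j, -Real.logb 2
        (q (Fin.init (window x (k + 1) j)) (window x (k + 1) j (Fin.last k))) := by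
    refine le_trans (le_of_eq (Finset.sum_congr rfl fun j _ => ?_)) h
    rw [← h1 j]
    congr!
  rcases Nat.eq_zero_or_pos (n - (k + 1)) with h0 | h0
  · have : IsEmpty (Fin (n - (k + 1))) := by rw [h0]; infer_instance
    rw [weightCost_eq_sum _ hx]
    simp
  rw [weightCost_eq_sum _ hx, ENNReal.ofReal_div_of_pos (by positivity), ENNReal.ofReal_natCast]
  simp_rw [idealWeight_eq, if_neg (condFreq_window_pos _ _ _).ne']
  rw [← ENNReal.ofReal_sum_of_nonneg fun j _ => neg_nonneg.2 (Real.logb_nonpos (by norm_num)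
    (condFreq_nonneg _ _ _) (condFreq_le_one _ _ _))]
  gcongr

/-! ### Quantization error and quantized alphabet -/

theorem measurable_quantize (b : ℕ) : Measurable (quantize b) := by
  have : quantize b = fun x => (⌊(2 : ℝ) ^ b * x⌋ : ℝ) / 2 ^ b := funext (quantize_eq_floor b)
  rw [this]
  fun_prop

theorem abs_quantize_sub_le (b : ℕ) (x : ℝ) : |quantize b x - x| ≤ 1 / 2 ^ b := by
  rw [quantize_eq_floor, abs_sub_comm, abs_of_nonneg]
  · have := Int.lt_floor_add_one ((2 : ℝ) ^ b * x)
    rw [sub_le_iff_le_add, ← add_div, le_div_iff₀ (by positivity)]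
    linarith
  · have := Int.floor_le ((2 : ℝ) ^ b * x)
    rw [sub_nonneg, div_le_iff₀ (by positivity)]
    linarith

theorem exists_finset_quantizedSet {𝒳 : Set ℝ} (h : Bornology.IsBounded 𝒳) :
    ∃ K : ℕ, 0 < K ∧ ∀ b, ∃ S : Finset ℝ, quantizedSet 𝒳 b = S ∧ S.card ≤ K * 2 ^ b := by
  obtain ⟨R, hR⟩ := h.exists_norm_le
  obtain ⟨R', hR'⟩ := exists_nat_ge R
  refine ⟨2 * R' + 1, by omega, fun b => ?_⟩
  have hsub : quantizedSet 𝒳 b ⊆ ((Finset.Icc (-(R' * 2 ^ b : ℤ)) (R' * 2 ^ b)).image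
      fun z : ℤ => (z : ℝ) / 2 ^ b : Finset ℝ) := by
    rintro _ ⟨x, hx, rfl⟩
    rw [quantize_eq_floor]
    have h1 := abs_le.1 ((Real.norm_eq_abs x ▸ hR x hx).trans hR')
    have h2 : (0 : ℝ) < 2 ^ b := by positivity
    simp only [Finset.coe_image, Set.mem_image, Finset.coe_Icc, Set.mem_Icc]
    refine ⟨⌊(2 : ℝ) ^ b * x⌋, ⟨?_, ?_⟩, rfl⟩
    · rw [Int.le_floor]
      push_cast
      nlinarith
    · have : ((⌊(2 : ℝ) ^ b * x⌋ : ℤ) : ℝ) ≤ ((R' * 2 ^ b : ℤ) : ℝ) := by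
        refine (Int.floor_le _).trans ?_
        push_cast
        nlinarith
      exact_mod_cast this
  have hfin : (quantizedSet 𝒳 b).Finite := (Finset.finite_toSet _).subset hsub
  refine ⟨hfin.toFinset, by simp, ?_⟩
  refine (Finset.card_le_card (Finset.coe_subset.1 (by rwa [Set.Finite.coe_toFinset]))).trans (Finset.card_image_le.trans ?_)
  rw [Int.card_Icc]
  have h1 : (R' * 2 ^ b + 1 - -(R' * 2 ^ b : ℤ)) = ((2 * R' * 2 ^ b + 1 : ℕ) : ℤ) := by
    push_cast; ring
  rw [h1, Int.toNat_natCast, add_mul]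
  have : 1 ≤ 2 ^ b := Nat.one_le_two_pow
  omega

/-! ### A weak law of large numbers -/

/-- Chebyshev's inequality for sums of bounded variables of equal mean whose correlations are
bounded beyond a given lag. -/
theorem measureReal_sum_ge_le {Ω : Type*} [MeasurableSpace Ω] {P : Measure Ω}
    [IsProbabilityMeasure P] {G : ℕ → Ω → ℝ} (hG : ∀ j, Measurable (G j)) {K μ η : ℝ}
    (h0 : ∀ j ω, 0 ≤ G j ω) (hK : ∀ j ω, G j ω ≤ K) (hμ : ∀ j, ∫ ω, G j ω ∂P = μ) (hη : 0 ≤ η)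
    {g : ℕ} (hcorr : ∀ i j, i + g ≤ j → ∫ ω, G i ω * G j ω ∂P ≤ (1 + η) * μ ^ 2)
    {N : ℕ} (hN : 0 < N) {t : ℝ} (ht : 0 < t) :
    P.real {ω | N * (μ + t) ≤ ∑ j ∈ Finset.range N, G j ω}
      ≤ (2 * g / N + η) * (K ^ 2 / t ^ 2) := by
  have hint : ∀ j, MemLp (G j) 2 P := fun j => by
    refine MemLp.of_bound (hG j).aestronglyMeasurable K (ae_of_all _ fun ω => ?_)
    rw [Real.norm_eq_abs, abs_of_nonneg (h0 j ω)]
    exact hK j ω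
  have hμ0 : 0 ≤ μ := by rw [← hμ 0]; exact integral_nonneg (h0 0)
  have hμK : μ ≤ K := by
    rw [← hμ 0]
    refine (integral_mono ((hint 0).integrable (by norm_num)) (integrable_const K)
      fun ω => hK 0 ω).trans (by simp)
  have hcov : ∀ i j, cov[G i, G j; P] = ∫ ω, G i ω * G j ω ∂P - μ ^ 2 := by
    intro i j
    rw [covariance_eq_sub (hint i) (hint j), hμ, hμ, sq]
    rfl
  -- Only upper bounds on covariances are needed for the variance, so the one-sided control given by
  -- `ψ*` suffices.
  have hfar : ∀ i j, i + g ≤ j → cov[G i, G j; P] ≤ η * K ^ 2 := by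
    intro i j hij
    rw [hcov]
    have h1 := hcorr i j hij
    have h2 : μ ^ 2 ≤ K ^ 2 := by gcongr
    nlinarith
  have hnear : ∀ i j, cov[G i, G j; P] ≤ K ^ 2 := by
    intro i j
    rw [hcov]
    have h1 : ∫ ω, G i ω * G j ω ∂P ≤ K ^ 2 := by
      refine (integral_mono ((hint i).integrable_mul (hint j)) (integrable_const (K ^ 2))
        fun ω => ?_).trans (by simp)
      rw [sq]
      exact mul_le_mul (hK i ω) (hK j ω) (h0 j ω) ((h0 i ω).trans (hK i ω))
    nlinarith [sq_nonneg μ]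
  have hvar : Var[fun ω => ∑ j ∈ Finset.range N, G j ω; P]
      ≤ N * (2 * g) * K ^ 2 + N * N * (η * K ^ 2) := by
    rw [variance_fun_sum' fun i _ => hint i]
    have h1 : ∀ i, ∑ j ∈ Finset.range N, cov[G i, G j; P]
        ≤ 2 * g * K ^ 2 + N * (η * K ^ 2) := by
      intro i
      -- At most `2g` indices lie within the lag of `i`; they get the trivial bound `K²`.
      have h2 : ∀ j, cov[G i, G j; P]
          ≤ (if j ∈ Finset.Ico (i + 1 - g) (i + g) then K ^ 2 else 0) + η * K ^ 2 := by
        intro j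
        have hηK : 0 ≤ η * K ^ 2 := by positivity
        split_ifs with hj
        · linarith [hnear i j]
        · rw [zero_add]
          rw [Finset.mem_Ico] at hj
          by_cases hij : i + g ≤ j
          · exact hfar i j hij
          · rw [covariance_comm]
            exact hfar j i (by omega)
      refine (Finset.sum_le_sum fun j _ => h2 j).trans ?_
      rw [Finset.sum_add_distrib, ← Finset.sum_filter, Finset.sum_const, Finset.sum_const,
        nsmul_eq_mul, nsmul_eq_mul, Finset.card_range]
      gcongr
      have h3 : (Finset.filter (fun j => j ∈ Finset.Ico (i + 1 - g) (i + g))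
          (Finset.range N)).card ≤ 2 * g := by
        refine (Finset.card_le_card (t := Finset.Ico (i + 1 - g) (i + g)) ?_).trans ?_
        · intro j hj
          exact (Finset.mem_filter.1 hj).2
        · rw [Nat.card_Ico]; omega
      exact_mod_cast h3
    refine (Finset.sum_le_sum fun i _ => h1 i).trans (le_of_eq ?_)
    rw [Finset.sum_const, Finset.card_range, nsmul_eq_mul]
    ring
  have hmean : ∫ ω, ∑ j ∈ Finset.range N, G j ω ∂P = N * μ := by
    rw [integral_finsetSum _ fun j _ => (hint j).integrable (by norm_num)]
    simp [hμ]
  have hNt : 0 < (N : ℝ) * t := by positivity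
  have hcheb := meas_ge_le_variance_div_sq
    (memLp_finsetSum (Finset.range N) fun j _ => hint j) hNt
  rw [hmean] at hcheb
  have h3 : P.real {ω | N * (μ + t) ≤ ∑ j ∈ Finset.range N, G j ω}
      ≤ Var[fun ω => ∑ j ∈ Finset.range N, G j ω; P] / (N * t) ^ 2 := by
    refine ENNReal.toReal_le_of_le_ofReal (div_nonneg (variance_nonneg _ _) (by positivity)) ?_
    refine (measure_mono (Set.ofPred_subset_ofPred.2 fun ω hω => ?_)).trans hcheb
    refine le_trans ?_ (le_abs_self _)
    linarith
  refine h3.trans ?_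
  rw [div_le_iff₀ (by positivity)]
  refine hvar.trans (le_of_eq ?_)
  have : (N : ℝ) ≠ 0 := by positivity
  field_simp

/-! ### Windows of the quantized process -/

section QuantizedProcess

variable {Ω : Type*} {X : ℕ → Ω → ℝ}

/-- The window of length `L` that starts at `j` of the quantized process. -/
noncomputable def qWindow (X : ℕ → Ω → ℝ) (b L j : ℕ) (ω : Ω) : Fin L → ℝ := fun t => quantize b (X (j + t) ω)

theorem measurableSet_qWindow_eq (b L j : ℕ) (I : Set ℕ) (hI : ∀ t < L, j + t ∈ I)
    (a : Fin L → ℝ) : MeasurableSet[sigmaField X I] {ω | qWindow X b L j ω = a} := by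
  have h : {ω | qWindow X b L j ω = a}
      = ⋂ t : Fin L, X (j + t) ⁻¹' (quantize b ⁻¹' {a t}) := by
    ext ω
    simp [qWindow, funext_iff]
  rw [h]
  refine @MeasurableSet.iInter _ _ (sigmaField X I) _ _ fun t => ?_
  have hle : MeasurableSpace.comap (X (j + t)) inferInstance ≤ sigmaField X I :=
    le_iSup₂_of_le (j + (t : ℕ)) (hI t t.2) le_rfl
  exact hle _ ⟨_, measurable_quantize b (measurableSet_singleton _), rfl⟩

/-- A function of the window that starts at `j`, set to zero off the finite set `T`. -/
noncomputable def windowFun (X : ℕ → Ω → ℝ) (b L : ℕ) (T : Finset (Fin L → ℝ))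
    (f : (Fin L → ℝ) → ℝ) (j : ℕ) (ω : Ω) : ℝ :=
  ∑ a ∈ T, {ω | qWindow X b L j ω = a}.indicator (fun _ => f a) ω

variable {b L : ℕ} {T : Finset (Fin L → ℝ)} {f : (Fin L → ℝ) → ℝ}

theorem windowFun_eq (j : ℕ) (ω : Ω) : windowFun X b L T f j ω
    = if qWindow X b L j ω ∈ T then f (qWindow X b L j ω) else 0 := by
  classical
  unfold windowFun
  simp only [Set.indicator_apply, Set.mem_ofPred_eq]
  rw [Finset.sum_ite_eq]

theorem qWindow_succ_eq_snoc_iff (j : ℕ) (ω : Ω) {l : ℕ} (s : Fin l → ℝ) (c : ℝ) :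
    qWindow X b (l + 1) j ω = Fin.snoc s c
      ↔ qWindow X b l j ω = s ∧ quantize b (X (j + l) ω) = c := by
  constructor
  · intro h
    constructor
    · ext t
      have := congrFun h t.castSucc
      simpa [qWindow] using this
    · have := congrFun h (Fin.last l)
      simpa [qWindow] using this
  · rintro ⟨rfl, rfl⟩
    ext t
    refine Fin.lastCases ?_ (fun t => ?_) t <;> simp [qWindow]

theorem qWindow_zero (X : ℕ → Ω → ℝ) (b l : ℕ) :
    qWindow X b l 0 = fun ω (i : Fin l) => quantize b (X i ω) := by
  ext ω i
  simp [qWindow]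

variable [MeasurableSpace Ω] {P : Measure Ω}

theorem measurable_qWindow (hX : ∀ i, Measurable (X i)) (b L j : ℕ) :
    Measurable (qWindow X b L j) :=
  measurable_pi_lambda _ fun _ => (measurable_quantize b).comp (hX _)

/-- Multiplying out the quotient also covers null events, which the supremum excludes. -/
theorem measure_inter_le_psiStar_mul [IsFiniteMeasure P] {g j : ℕ} {A B : Set Ω}
    (hA : MeasurableSet[sigmaField X (Set.Iic j)] A)
    (hB : MeasurableSet[sigmaField X (Set.Ici (j + g))] B) :
    P (A ∩ B) ≤ psiStar P X g * (P A * P B) := by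
  rcases eq_or_ne (P A * P B) 0 with h0 | h0
  · have : P (A ∩ B) = 0 := by
      rcases mul_eq_zero.1 h0 with h | h
      · exact measure_mono_null Set.inter_subset_left h
      · exact measure_mono_null Set.inter_subset_right h
    simp [this]
  · rw [← ENNReal.div_le_iff h0 (ENNReal.mul_ne_top (measure_ne_top _ _) (measure_ne_top _ _))]
    unfold psiStar
    exact le_iSup_of_le j (le_iSup_of_le A (le_iSup_of_le B (le_iSup_of_le hA (le_iSup_of_le hB
      (le_iSup_of_le (pos_iff_ne_zero.2 h0) le_rfl)))))

theorem IsStationary.identDistrib_add (hX : ∀ i, Measurable (X i)) (h : IsStationary P X)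
    (j : ℕ) : IdentDistrib (fun ω (i : ℕ) => X (i + j) ω) (fun ω (i : ℕ) => X i ω) P P := by
  induction j with
  | zero => exact IdentDistrib.refl (measurable_pi_lambda _ fun i => hX i).aemeasurable
  | succ j ih =>
    refine IdentDistrib.trans ?_ ih
    have := h.comp (u := fun (x : ℕ → ℝ) (i : ℕ) => x (i + j)) (by fun_prop)
    have e : ∀ i, i + j + 1 = i + (j + 1) := fun i => by omega
    simpa [Function.comp_def, e] using this

theorem measureReal_qWindow_eq (hX : ∀ i, Measurable (X i)) (h : IsStationary P X) (b L j : ℕ)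
    (a : Fin L → ℝ) :
    P.real {ω | qWindow X b L j ω = a} = P.real {ω | qWindow X b L 0 ω = a} := by
  have hu : Measurable fun (x : ℕ → ℝ) (t : Fin L) => quantize b (x t) :=
    measurable_pi_lambda _ fun t => (measurable_quantize b).comp (measurable_pi_apply _)
  have h1 := ((h.identDistrib_add hX j).comp hu).measure_mem_eq (measurableSet_singleton a)
  have h2 : ∀ j, qWindow X b L j
      = (fun (x : ℕ → ℝ) (t : Fin L) => quantize b (x t)) ∘ fun ω (i : ℕ) => X (i + j) ω := by
    intro j
    ext ω t
    simp [qWindow, add_comm]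
  have h3 := congrArg ENNReal.toReal h1
  unfold Measure.real
  rw [h2 j, h2 0]
  exact h3

theorem measurableSet_qWindow (hX : ∀ i, Measurable (X i)) (b L j : ℕ) (a : Fin L → ℝ) :
    MeasurableSet {ω | qWindow X b L j ω = a} :=
  measurable_qWindow hX b L j (measurableSet_singleton a)

theorem measurable_windowFun (hX : ∀ i, Measurable (X i)) (j : ℕ) :
    Measurable (windowFun X b L T f j) :=
  Finset.measurable_sum _ fun a _ =>
    measurable_const.indicator (measurableSet_qWindow hX b L j a)

theorem integral_windowFun [IsFiniteMeasure P] (hX : ∀ i, Measurable (X i)) (j : ℕ) :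
    ∫ ω, windowFun X b L T f j ω ∂P
      = ∑ a ∈ T, P.real {ω | qWindow X b L j ω = a} * f a := by
  unfold windowFun
  rw [integral_finsetSum]
  · refine Finset.sum_congr rfl fun a _ => ?_
    rw [integral_indicator (measurableSet_qWindow hX b L j a)]
    simp
  · exact fun a _ => (integrable_const _).indicator (measurableSet_qWindow hX b L j a)

/-- The product expands into indicators of pairs of window events. Since `f` is nonnegative, the
mixing inequality can be applied termwise. -/
theorem integral_windowFun_mul_le [IsProbabilityMeasure P] (hX : ∀ i, Measurable (X i))
    (hf : ∀ a ∈ T, 0 ≤ f a) {g : ℕ} {η : ℝ} (hη : 0 ≤ η)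
    (hg : psiStar P X g ≤ ENNReal.ofReal (1 + η)) {i j : ℕ} (hij : i + (L + g) ≤ j) :
    ∫ ω, windowFun X b L T f i ω * windowFun X b L T f j ω ∂P
      ≤ (1 + η) * ((∫ ω, windowFun X b L T f i ω ∂P) * ∫ ω, windowFun X b L T f j ω ∂P) := by
  have hmix : ∀ a c, P.real ({ω | qWindow X b L i ω = a} ∩ {ω | qWindow X b L j ω = c})
      ≤ (1 + η) * (P.real {ω | qWindow X b L i ω = a} * P.real {ω | qWindow X b L j ω = c}) := by
    intro a c
    have h1 := measure_inter_le_psiStar_mul (P := P) (g := g) (j := i + L)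
      (measurableSet_qWindow_eq (X := X) b L i (Set.Iic (i + L))
        (fun t ht => by simp only [Set.mem_Iic]; omega) a)
      (measurableSet_qWindow_eq (X := X) b L j (Set.Ici (i + L + g))
        (fun t ht => by simp only [Set.mem_Ici]; omega) c)
    have h2 := h1.trans (mul_le_mul_left hg _)
    have h3 := ENNReal.toReal_mono (ENNReal.mul_ne_top ENNReal.ofReal_ne_top
      (ENNReal.mul_ne_top (measure_ne_top _ _) (measure_ne_top _ _))) h2
    rwa [ENNReal.toReal_mul, ENNReal.toReal_mul, ENNReal.toReal_ofReal (by linarith)] at h3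
  have hprod : ∀ ω, windowFun X b L T f i ω * windowFun X b L T f j ω
      = ∑ a ∈ T, ∑ c ∈ T, ({ω | qWindow X b L i ω = a} ∩ {ω | qWindow X b L j ω = c}).indicator
        (fun _ => f a * f c) ω := by
    intro ω
    unfold windowFun
    rw [Finset.sum_mul_sum]
    refine Finset.sum_congr rfl fun a _ => Finset.sum_congr rfl fun c _ => ?_
    rw [Set.inter_indicator_mul (fun _ => f a) (fun _ => f c)]
  have hm : ∀ a c, MeasurableSet
      ({ω | qWindow X b L i ω = a} ∩ {ω | qWindow X b L j ω = c}) := fun a c =>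
    (measurableSet_qWindow hX b L i a).inter (measurableSet_qWindow hX b L j c)
  simp_rw [hprod]
  rw [integral_finsetSum _ fun a _ => integrable_finsetSum _ fun c _ =>
    (integrable_const _).indicator (hm a c), integral_windowFun hX, integral_windowFun hX,
    Finset.sum_mul_sum, Finset.mul_sum]
  refine Finset.sum_le_sum fun a ha => ?_
  rw [integral_finsetSum _ fun c _ => (integrable_const _).indicator (hm a c), Finset.mul_sum]
  refine Finset.sum_le_sum fun c hc => ?_
  rw [integral_indicator (hm a c)]
  simp only [integral_const, MeasurableSet.univ, measureReal_restrict_apply, Set.univ_inter,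
    smul_eq_mul]
  have h1 := mul_le_mul_of_nonneg_right (hmix a c) (mul_nonneg (hf a ha) (hf c hc))
  refine h1.trans (le_of_eq ?_)
  ring

/-! ### The code given by the true conditional distribution -/

/-- The conditional distribution of a quantized symbol given the `l` preceding ones, mixed with the
uniform distribution on `S`. -/
noncomputable def mixKernel (P : Measure Ω) (X : ℕ → Ω → ℝ) (b l : ℕ) (S : Finset ℝ)
    (s : Fin l → ℝ) (c : ℝ) : ℝ :=
  (P.real {ω | qWindow X b (l + 1) 0 ω = Fin.snoc s c} / P.real {ω | qWindow X b l 0 ω = s}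
    + 1 / S.card) / 2

/-- The code length of the last symbol of `a` for the kernel `mixKernel`. -/
noncomputable def codeLen (P : Measure Ω) (X : ℕ → Ω → ℝ) (b l : ℕ) (S : Finset ℝ)
    (a : Fin (l + 1) → ℝ) : ℝ :=
  -Real.logb 2 (mixKernel P X b l S (Fin.init a) (a (Fin.last l)))

variable {l : ℕ} {S : Finset ℝ}

theorem mixKernel_nonneg (s : Fin l → ℝ) (c : ℝ) : 0 ≤ mixKernel P X b l S s c := by
  unfold mixKernel; positivity

theorem one_div_le_mixKernel (s : Fin l → ℝ) (c : ℝ) :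
    1 / (2 * S.card : ℝ) ≤ mixKernel P X b l S s c := by
  have : 0 ≤ P.real {ω | qWindow X b (l + 1) 0 ω = Fin.snoc s c}
      / P.real {ω | qWindow X b l 0 ω = s} := by positivity
  unfold mixKernel
  have h : 1 / (2 * S.card : ℝ) = (1 / S.card) / 2 := by rw [mul_comm, div_div]
  rw [h]
  linarith

theorem sum_mixKernel_le_one [IsProbabilityMeasure P] (hX : ∀ i, Measurable (X i))
    (s : Fin l → ℝ) : ∑ c ∈ S, mixKernel P X b l S s c ≤ 1 := by
  unfold mixKernel
  rw [← Finset.sum_div, Finset.sum_add_distrib, ← Finset.sum_div, Finset.sum_const, nsmul_eq_mul]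
  have h1 : ∑ c ∈ S, P.real {ω | qWindow X b (l + 1) 0 ω = Fin.snoc s c}
      ≤ P.real {ω | qWindow X b l 0 ω = s} := by
    rw [← measureReal_biUnion_finset]
    · refine measureReal_mono ?_ (measure_ne_top _ _)
      intro ω hω
      simp only [Set.mem_iUnion] at hω
      obtain ⟨c, -, hc⟩ := hω
      exact ((qWindow_succ_eq_snoc_iff 0 ω s c).1 hc).1
    · intro c _ c' _ hcc'
      refine Set.disjoint_left.2 fun ω hω hω' => hcc' ?_
      rw [← ((qWindow_succ_eq_snoc_iff 0 ω s c).1 hω).2,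
        ← ((qWindow_succ_eq_snoc_iff 0 ω s c').1 hω').2]
    · exact fun c _ => measurableSet_qWindow hX b (l + 1) 0 _
  have h2 := div_le_one_of_le₀ h1 measureReal_nonneg
  have h3 : (S.card : ℝ) * (1 / S.card) ≤ 1 := by
    rw [mul_one_div]
    exact div_self_le_one _
  linarith

theorem codeLen_nonneg [IsProbabilityMeasure P] (hX : ∀ i, Measurable (X i))
    {a : Fin (l + 1) → ℝ} (ha : a ∈ Fintype.piFinset fun _ : Fin (l + 1) => S) :
    0 ≤ codeLen P X b l S a := by
  refine neg_nonneg.2 (Real.logb_nonpos (by norm_num) (mixKernel_nonneg _ _) ?_)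
  exact (Finset.single_le_sum (f := fun c => mixKernel P X b l S (Fin.init a) c)
    (fun c _ => mixKernel_nonneg _ _) (Fintype.mem_piFinset.1 ha _)).trans
    (sum_mixKernel_le_one hX _)

/-- The uniform half of the mixture keeps code lengths of order `b`, as Chebyshev's inequality
requires. -/
theorem codeLen_le (hS : 0 < S.card) (a : Fin (l + 1) → ℝ) :
    codeLen P X b l S a ≤ 1 + Real.logb 2 S.card := by
  have hS' : (0 : ℝ) < S.card := by exact_mod_cast hS
  have h := Real.logb_le_logb_of_le (b := 2) (by norm_num) (by positivity)
    (one_div_le_mixKernel (P := P) (X := X) (b := b) (S := S) (Fin.init a) (a (Fin.last l)))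
  rw [one_div, Real.logb_inv, Real.logb_mul (by norm_num) hS'.ne',
    Real.logb_self_eq_one (by norm_num)] at h
  unfold codeLen
  linarith

/-- The true conditional law has weight one half in the mixture, so smoothing costs at most one bit.
-/
theorem sum_codeLen_le [IsProbabilityMeasure P] (hX : ∀ i, Measurable (X i)) :
    ENNReal.ofReal (∑ a ∈ Fintype.piFinset fun _ : Fin (l + 1) => S,
        P.real {ω | qWindow X b (l + 1) 0 ω = a} * codeLen P X b l S a)
      ≤ 1 + condEntropy P (fun ω => quantize b (X l ω))
        (fun ω (i : Fin l) => quantize b (X i ω)) := by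
  set T := Fintype.piFinset fun _ : Fin (l + 1) => S with hT
  set p : (Fin (l + 1) → ℝ) → ℝ := fun a => P.real {ω | qWindow X b (l + 1) 0 ω = a} with hp
  set p' : (Fin l → ℝ) → ℝ := fun s => P.real {ω | qWindow X b l 0 ω = s} with hp'
  have hp0 : ∀ a, 0 ≤ p a := fun a => measureReal_nonneg
  have hpp' : ∀ s c, p (Fin.snoc s c) ≤ p' s := fun s c =>
    measureReal_mono (fun ω hω => ((qWindow_succ_eq_snoc_iff 0 ω s c).1 hω).1) (measure_ne_top _ _)
  have hterm : ∀ a, p a * codeLen P X b l S a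
      ≤ p a + p a * Real.logb 2 (p' (Fin.init a) / p a) := by
    intro a
    rcases (hp0 a).eq_or_lt with h0 | h0
    · simp [← h0]
    have h1 : p a ≤ p' (Fin.init a) := by
      have := hpp' (Fin.init a) (a (Fin.last l))
      rwa [Fin.snoc_init_self] at this
    have h2 : 0 < p' (Fin.init a) := h0.trans_le h1
    have h3 : p a / p' (Fin.init a) / 2 ≤ mixKernel P X b l S (Fin.init a) (a (Fin.last l)) := by
      unfold mixKernel
      rw [Fin.snoc_init_self]
      have : (0 : ℝ) ≤ 1 / S.card := by positivity
      gcongr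
      linarith
    have h4 := Real.logb_le_logb_of_le (b := 2) (by norm_num) (by positivity) h3
    rw [Real.logb_div (by positivity) (by norm_num), Real.logb_self_eq_one (by norm_num),
      ← inv_div, Real.logb_inv] at h4
    have h5 : codeLen P X b l S a ≤ 1 + Real.logb 2 (p' (Fin.init a) / p a) := by
      unfold codeLen
      linarith
    have := mul_le_mul_of_nonneg_left h5 h0.le
    linarith
  have hlog : ∀ s c, 0 ≤ p (Fin.snoc s c) * Real.logb 2 (p' s / p (Fin.snoc s c)) := by
    intro s c
    rcases (hp0 (Fin.snoc s c)).eq_or_lt with h0 | h0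
    · simp [← h0]
    · refine mul_nonneg h0.le (Real.logb_nonneg (by norm_num) ?_)
      rw [le_div_iff₀ h0, one_mul]
      exact hpp' s c
  have hsum1 : ∑ a ∈ T, p a ≤ 1 := by
    rw [hp, ← measureReal_biUnion_finset]
    · exact measureReal_le_one
    · intro a _ a' _ haa'
      exact Set.disjoint_left.2 fun ω hω hω' => haa' (hω.symm.trans hω')
    · exact fun a _ => measurableSet_qWindow hX b (l + 1) 0 _
  have h1 : ∑ a ∈ T, p a * codeLen P X b l S a
      ≤ 1 + ∑ s ∈ Fintype.piFinset fun _ : Fin l => S, ∑ c ∈ S,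
          p (Fin.snoc s c) * Real.logb 2 (p' s / p (Fin.snoc s c)) := by
    refine (Finset.sum_le_sum fun a _ => hterm a).trans ?_
    rw [Finset.sum_add_distrib]
    refine add_le_add hsum1 (le_of_eq ?_)
    rw [hT, sum_piFinset_snoc]
    simp
  refine (ENNReal.ofReal_le_ofReal h1).trans ?_
  rw [ENNReal.ofReal_add (by norm_num) (Finset.sum_nonneg fun s _ => Finset.sum_nonneg fun c _ =>
    hlog s c), ENNReal.ofReal_one, ENNReal.ofReal_sum_of_nonneg fun s _ =>
      Finset.sum_nonneg fun c _ => hlog s c]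
  gcongr
  unfold condEntropy
  refine le_trans (Finset.sum_le_sum fun s _ => ?_) (ENNReal.sum_le_tsum _)
  rw [ENNReal.ofReal_sum_of_nonneg fun c _ => hlog s c]
  refine le_trans (Finset.sum_le_sum fun c _ => le_of_eq ?_) (ENNReal.sum_le_tsum S)
  have e1 : p (Fin.snoc s c) = P.real {ω | (fun i : Fin l => quantize b (X i ω)) = s
      ∧ quantize b (X l ω) = c} := by
    simp only [hp, qWindow_succ_eq_snoc_iff]
    simp only [qWindow_zero, Nat.zero_add]
  have e2 : p' s = P.real {ω | (fun i : Fin l => quantize b (X i ω)) = s} := by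
    simp only [hp', qWindow_zero]
  rw [e1, e2]

end QuantizedProcess

/-! ### Empirical conditional entropy and information dimension -/

section Concentration

variable {Ω : Type*} [MeasurableSpace Ω] {P : Measure Ω} {X : ℕ → Ω → ℝ} {𝒳 : Set ℝ}

/-- Conditional entropies of some fixed order are eventually below the information dimension. -/
theorem exists_condEntropy_le (hd : upperID P X ≠ ∞) {ε : ℝ} (hε : 0 < ε) :
    ∃ l : ℕ, ∀ᶠ b : ℕ in atTop, condEntropy P (fun ω => quantize b (X l ω))
      (fun ω (i : Fin l) => quantize b (X i ω))
        ≤ ENNReal.ofReal (b * ((upperID P X).toReal + ε)) := by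
  have h1 : upperID P X < ENNReal.ofReal ((upperID P X).toReal + ε) := by
    rw [ENNReal.lt_ofReal_iff_toReal_lt hd]
    linarith
  obtain ⟨l, hl⟩ := (eventually_lt_of_limsup_lt h1).exists
  refine ⟨l, ?_⟩
  filter_upwards [eventually_lt_of_limsup_lt hl, eventually_gt_atTop 0] with b hb hb0
  have h2 := hb.le
  rw [ENNReal.div_le_iff (by exact_mod_cast hb0.ne') (by simp), ← ENNReal.ofReal_natCast,
    ← ENNReal.ofReal_mul (by positivity), mul_comm] at h2
  exact h2

variable [IsProbabilityMeasure P]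

/-- The cost of the quantized samples for their ideal weights, bounded by the code length with a
kernel of smaller order. -/
theorem weightCost_samples_le (hX : ∀ i, Measurable (X i)) {b n k l : ℕ} {S : Finset ℝ}
    (hS : quantizedSet 𝒳 b = S) (hcard : 0 < S.card) (hlk : l ≤ k) {ω : Ω} (hω : ∀ i, X i ω ∈ 𝒳) :
    weightCost 𝒳 b k (idealWeight (fun i => quantize b (samples X n ω i)) k)
        (fun i => quantize b (samples X n ω i))
      ≤ ENNReal.ofReal ((∑ j ∈ Finset.range (n - (k + 1)), windowFun X b (l + 1)
        (Fintype.piFinset fun _ => S) (codeLen P X b l S) (j + (k - l)) ω)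
          / (n - (k + 1) : ℕ)) := by
  have hx : (fun i => quantize b (samples X n ω i)) ∈ blocks 𝒳 b n := fun i => ⟨_, hω _, rfl⟩
  have hpos : (0 : ℝ) < 1 / (2 * S.card) := by positivity
  -- A kernel of order `l` is one of order `k` that reads only the last `l` symbols of its context;
  -- hence the shift by `k - l`.
  let q : (Fin k → ℝ) → ℝ → ℝ := fun s c =>
    mixKernel P X b l S (fun i : Fin l => s ⟨k - l + i, by omega⟩) c
  have hq0 : ∀ s c, 0 ≤ q s c := fun _ _ => mixKernel_nonneg _ _
  have hqpos : ∀ s, ∀ c ∈ S, 0 < q s c := fun _ c _ => hpos.trans_le (one_div_le_mixKernel _ c)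
  have hqsum : ∀ s, ∑ c ∈ S, q s c ≤ 1 := fun _ => sum_mixKernel_le_one hX _
  have h := weightCost_idealWeight_le hS hx q hq0 hqpos hqsum
  have hterm : ∀ j : Fin (n - (k + 1)),
      -Real.logb 2 (mixKernel P X b l S (fun i : Fin l => Fin.init (window
        (fun i => quantize b (samples X n ω i)) (k + 1) j) ⟨k - l + i, by omega⟩)
        (window (fun i => quantize b (samples X n ω i)) (k + 1) j (Fin.last k)))
      = windowFun X b (l + 1) (Fintype.piFinset fun _ => S) (codeLen P X b l S)
        (j + (k - l)) ω := by
    intro j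
    have hmem : qWindow X b (l + 1) (j + (k - l)) ω
        ∈ Fintype.piFinset fun _ : Fin (l + 1) => S := by
      rw [Fintype.mem_piFinset]
      intro t
      rw [← Finset.mem_coe, ← hS]
      exact ⟨_, hω _, rfl⟩
    rw [windowFun_eq, if_pos hmem, codeLen]
    have h1 : (fun i : Fin l => Fin.init (window
        (fun i => quantize b (samples X n ω i)) (k + 1) j) ⟨k - l + i, by omega⟩)
        = Fin.init (qWindow X b (l + 1) (j + (k - l)) ω) := by
      ext i
      simp [Fin.init, qWindow, window, samples, add_assoc]
    have h2 : window (fun i => quantize b (samples X n ω i)) (k + 1) j (Fin.last k)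
        = qWindow X b (l + 1) (j + (k - l)) ω (Fin.last l) := by
      have : (j : ℕ) + (k - l) + l = j + k := by omega
      simp [qWindow, window, samples, this]
    rw [h1, h2]
  rw [Finset.sum_congr rfl fun j _ => hterm j] at h
  rwa [Finset.sum_range]

/-- The comparison kernel has a fixed order `l` although `k` grows. Mean, bound and deviation of its
code length all scale with `b`, so Chebyshev's bound is uniform in the quantization level. -/
theorem tendsto_measure_weightCost_samples (hXmeas : ∀ i, Measurable (X i))
    (hX𝒳 : ∀ i, ∀ᵐ ω ∂P, X i ω ∈ 𝒳) (h𝒳 : Bornology.IsBounded 𝒳) (hstat : IsStationary P X)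
    (hmix : IsPsiStarMixing P X) (hd : upperID P X ≠ ∞) {b k : ℕ → ℕ} (hb : Tendsto b atTop atTop)
    (hk : Tendsto k atTop atTop) (hN : Tendsto (fun n => n - (k n + 1)) atTop atTop)
    {ε : ℝ} (hε : 0 < ε) :
    Tendsto (fun n => P {ω | ¬ weightCost 𝒳 (b n) (k n)
        (idealWeight (fun i => quantize (b n) (samples X n ω i)) (k n))
        (fun i => quantize (b n) (samples X n ω i))
          ≤ ENNReal.ofReal (b n * ((upperID P X).toReal + ε))}) atTop (𝓝 0) := by
  obtain ⟨l, hl⟩ := exists_condEntropy_le hd (show 0 < ε / 4 by positivity)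
  obtain ⟨M, hM0, hM⟩ := exists_finset_quantizedSet h𝒳
  choose S hS hScard using hM
  have hX𝒳' : ∀ᵐ ω ∂P, ∀ i, X i ω ∈ 𝒳 := ae_all_iff.2 hX𝒳
  have hcard : ∀ b, 0 < (S b).card := by
    intro b
    obtain ⟨ω, hω⟩ := hX𝒳'.exists
    refine Finset.card_pos.2 ⟨quantize b (X 0 ω), ?_⟩
    rw [← Finset.mem_coe, ← hS]
    exact ⟨_, hω 0, rfl⟩
  set d := (upperID P X).toReal with hdd
  have hd0 : 0 ≤ d := ENNReal.toReal_nonneg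
  set C : ℝ := 2 + Real.logb 2 M with hC
  have hM1 : (1 : ℝ) ≤ M := by exact_mod_cast hM0
  have hlogM : 0 ≤ Real.logb 2 M := Real.logb_nonneg (by norm_num) hM1
  rw [ENNReal.tendsto_nhds_zero]
  intro e he
  rcases eq_or_ne e ∞ with rfl | he'
  · exact Eventually.of_forall fun _ => le_top
  have heR : 0 < e.toReal := ENNReal.toReal_pos he.ne' he'
  -- `Q` is the ratio `K² / t²` for `K = C B` and `t = B ε / 2`, free of `B`. With `η = e / (2Q)`
  -- the final bound `2ηQ` equals `e`.
  set Q : ℝ := (2 * C / ε) ^ 2 with hQ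
  have hC0 : 0 < C := by positivity
  have hQ0 : 0 < Q := by positivity
  set η : ℝ := e.toReal / (2 * Q) with hη
  have hη0 : 0 < η := by positivity
  have hmix' : ∀ᶠ g in atTop, psiStar P X g ≤ ENNReal.ofReal (1 + η) := by
    have h1 : (1 : ℝ≥0∞) < ENNReal.ofReal (1 + η) := by
      rw [← ENNReal.ofReal_one]
      exact (ENNReal.ofReal_lt_ofReal_iff (by linarith)).2 (by linarith)
    exact (hmix.eventually_lt_const h1).mono fun g hg => hg.le
  -- The gap depends on `η` only: mixing of the unquantized process controls all quantization levels
  -- at once.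
  obtain ⟨g, hg⟩ := hmix'.exists
  set g' : ℕ := l + 1 + g with hg'
  have hNlim : Tendsto (fun n => 2 * (g' : ℝ) / ((n - (k n + 1) : ℕ) : ℝ)) atTop (𝓝 0) :=
    Tendsto.div_atTop tendsto_const_nhds (tendsto_natCast_atTop_atTop.comp hN)
  have hbig : ∀ᶠ b : ℕ in atTop, 4 / ε ≤ b :=
    tendsto_natCast_atTop_atTop.eventually_ge_atTop (4 / ε)
  filter_upwards [hb.eventually hl, hk.eventually_ge_atTop l, hN.eventually_gt_atTop 0,
    hNlim.eventually_le_const hη0, hb.eventually hbig, hb.eventually_ge_atTop 1]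
    with n hn1 hn2 hn3 hn4 hn5 hn6
  set B := b n with hB
  set N := n - (k n + 1) with hNdef
  set T := Fintype.piFinset fun _ : Fin (l + 1) => S B with hT
  have hB1 : (1 : ℝ) ≤ B := by exact_mod_cast hn6
  have hfun0 : ∀ a ∈ T, 0 ≤ codeLen P X B l (S B) a := fun a ha => codeLen_nonneg hXmeas ha
  have hKle : 1 + Real.logb 2 (S B).card ≤ C * B := by
    have h1 : Real.logb 2 (S B).card ≤ Real.logb 2 (M * 2 ^ B) :=
      Real.logb_le_logb_of_le (by norm_num) (by exact_mod_cast hcard B)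
        (by exact_mod_cast hScard B)
    rw [Real.logb_mul (by positivity) (by positivity), Real.logb_pow,
      Real.logb_self_eq_one (by norm_num)] at h1
    rw [hC]
    nlinarith
  set G : ℕ → Ω → ℝ := fun j => windowFun X B (l + 1) T (codeLen P X B l (S B)) (j + (k n - l))
    with hG
  have hmean : ∀ j, ∫ ω, windowFun X B (l + 1) T (codeLen P X B l (S B)) j ω ∂P
      = ∑ a ∈ T, P.real {ω | qWindow X B (l + 1) 0 ω = a} * codeLen P X B l (S B) a := by
    intro j
    rw [integral_windowFun hXmeas]
    simp_rw [measureReal_qWindow_eq hXmeas hstat B (l + 1) j]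
  set μ := ∑ a ∈ T, P.real {ω | qWindow X B (l + 1) 0 ω = a} * codeLen P X B l (S B) a with hμ
  have hμle : μ ≤ B * (d + ε / 2) := by
    have h1 := (sum_codeLen_le (P := P) (b := B) (l := l) (S := S B) hXmeas).trans
      (add_le_add_right hn1 1)
    rw [← ENNReal.ofReal_one, ← ENNReal.ofReal_add (by norm_num) (by positivity),
      ENNReal.ofReal_le_ofReal_iff (by positivity)] at h1
    -- The extra bit from smoothing is negligible against `B ε`.
    have h2 : 1 ≤ B * (ε / 4) := by
      rw [div_le_iff₀ hε] at hn5
      linarith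
    change μ ≤ _ at h1
    linarith
  have hcheb := measureReal_sum_ge_le (P := P) (G := G) (K := C * B) (μ := μ) (η := η) (g := g')
    (N := N) (t := B * ε / 2)
    (fun j => measurable_windowFun hXmeas _)
    (fun j ω => by
      simp only [hG, windowFun_eq]
      split_ifs with h
      · exact hfun0 _ h
      · exact le_rfl)
    (fun j ω => by
      simp only [hG, windowFun_eq]
      split_ifs with h
      · exact (codeLen_le (hcard B) _).trans hKle
      · positivity)
    (fun j => hmean _) hη0.le
    (fun i j hij => by
      refine (integral_windowFun_mul_le hXmeas hfun0 hη0.le hg (by omega)).trans (le_of_eq ?_)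
      rw [hmean, hmean, sq])
    hn3 (by positivity)
  have hsub : P {ω | ¬ weightCost 𝒳 B (k n)
        (idealWeight (fun i => quantize B (samples X n ω i)) (k n))
        (fun i => quantize B (samples X n ω i)) ≤ ENNReal.ofReal (B * (d + ε))}
      ≤ P {ω | N * (μ + B * ε / 2) ≤ ∑ j ∈ Finset.range N, G j ω} := by
    refine measure_mono_ae ?_
    filter_upwards [hX𝒳'] with ω hω hω1
    change N * (μ + B * ε / 2) ≤ ∑ j ∈ Finset.range N, G j ω
    by_contra hlt
    rw [not_le] at hlt
    refine hω1 ((weightCost_samples_le (P := P) hXmeas (hS B) (hcard B) hn2 hω).trans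
      (ENNReal.ofReal_le_ofReal ?_))
    rw [div_le_iff₀ (by exact_mod_cast hn3)]
    refine hlt.le.trans ?_
    rw [mul_comm]
    refine mul_le_mul_of_nonneg_right ?_ (by positivity)
    linarith
  refine hsub.trans ?_
  rw [← ENNReal.ofReal_toReal he', ← ofReal_measureReal]
  refine ENNReal.ofReal_le_ofReal (hcheb.trans ?_)
  have h3 : (C * B) ^ 2 / (B * ε / 2) ^ 2 = Q := by
    rw [hQ, ← div_pow]
    congr 1
    field_simp
  rw [h3]
  have h4 : (2 * g' / N + η) * Q ≤ (η + η) * Q := by gcongr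
  refine h4.trans (le_of_eq ?_)
  rw [hη]
  field_simp
  ring

end Concentration

/-! ### Stability of the minimizer -/

/-- The cost averages the weights over positions, so a uniform error in the weights passes to the
cost unamplified. -/
theorem weightCost_le_add {𝒳 : Set ℝ} {b k n : ℕ} {w v : (Fin (k + 1) → ℝ) → ℝ≥0∞} {c : ℝ≥0∞}
    (hwv : ∀ a ∈ blocks 𝒳 b (k + 1), w a ≤ v a + c) {u : Fin n → ℝ} (hu : u ∈ blocks 𝒳 b n) :
    weightCost 𝒳 b k w u ≤ weightCost 𝒳 b k v u + c := by
  rw [weightCost_eq_sum _ hu, weightCost_eq_sum _ hu]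
  refine (ENNReal.div_le_div_right (Finset.sum_le_sum fun j _ =>
    hwv (window u (k + 1) j) fun t => hu _) _).trans ?_
  rw [Finset.sum_add_distrib, ENNReal.add_div, Finset.sum_const, nsmul_eq_mul, Finset.card_univ,
    Fintype.card_fin]
  gcongr
  exact ENNReal.div_le_of_le_mul (le_of_eq (mul_comm _ _))

theorem normSq_quantize_sub_le (b : ℕ) {n : ℕ} (x : Fin n → ℝ) :
    ‖WithLp.toLp 2 ((fun i => quantize b (x i)) - x)‖ ^ 2 ≤ n / 4 ^ b := by
  rw [normSq_toLp]
  have h : ∀ i : Fin n, ((fun i => quantize b (x i)) - x) i ^ 2 ≤ 1 / 4 ^ b := by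
    intro i
    have h1 : (1 : ℝ) / 4 ^ b = (1 / 2 ^ b) ^ 2 := by
      rw [div_pow, one_pow, ← pow_mul, mul_comm b 2, pow_mul]
      norm_num
    rw [h1, ← sq_abs]
    exact pow_le_pow_left₀ (abs_nonneg _) (abs_quantize_sub_le b (x i)) 2
  refine (Finset.sum_le_sum fun i _ => h i).trans (le_of_eq ?_)
  simp [div_eq_mul_inv]

/-- The reconstruction error of a minimizer, when the measurement matrix and the weights behave as
they do with high probability. -/
theorem IsAMEPSolution.normSq_sub_div_le {𝒳 : Set ℝ} {b k m n : ℕ} {lam d ε τ : ℝ}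
    {w : (Fin (k + 1) → ℝ) → ℝ≥0∞} {A : Matrix (Fin m) (Fin n) ℝ} {x xhat : Fin n → ℝ}
    (hsol : IsAMEPSolution 𝒳 b k w lam A (A *ᵥ x) xhat)
    (hx : (fun i => quantize b (x i)) ∈ blocks 𝒳 b n) (hn : 0 < n) (hd : 0 ≤ d) (hε : 0 < ε)
    (hτ : 0 < τ) (hlam : 4 ^ b ≤ lam) (hlam' : lam ≤ 4 * 4 ^ b) (hm : (d + 3 * ε) * n ≤ m)
    (hw : weightDist (blocks 𝒳 b (k + 1)) w (idealWeight (fun i => quantize b (x i)) k)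
      ≤ ENNReal.ofReal (b * ε))
    (hcost : weightCost 𝒳 b k (idealWeight (fun i => quantize b (x i)) k)
      (fun i => quantize b (x i)) ≤ ENNReal.ofReal (b * (d + ε / 2)))
    (hup : ‖WithLp.toLp 2 (A *ᵥ ((fun i => quantize b (x i)) - x))‖ ^ 2
      ≤ 8 * m * ‖WithLp.toLp 2 ((fun i => quantize b (x i)) - x)‖ ^ 2)
    (hlow : ∀ u ∈ blocks 𝒳 b n, weightCost 𝒳 b k (idealWeight (fun i => quantize b (x i)) k) u
        ≤ ENNReal.ofReal (b * (d + 5 / 2 * ε) + 32 * m / n) →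
      τ * m * ‖WithLp.toLp 2 (u - x)‖ ^ 2 ≤ ‖WithLp.toLp 2 (A *ᵥ (u - x))‖ ^ 2) :
    ‖WithLp.toLp 2 (x - xhat)‖ ^ 2 / n ≤ (b + 32) / (4 ^ b * τ) := by
  set z : Fin n → ℝ := fun i => quantize b (x i) with hz
  have hn' : (0 : ℝ) < n := by exact_mod_cast hn
  have hm' : (0 : ℝ) < m := lt_of_lt_of_le (by positivity) hm
  have h4 : (0 : ℝ) < 4 ^ b := by positivity
  have hlam0 : 0 < lam := h4.trans_le hlam
  have hw1 : ∀ a ∈ blocks 𝒳 b (k + 1), w a ≤ idealWeight z k a + ENNReal.ofReal (b * ε) := by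
    intro a ha
    exact tsub_le_iff_left.1 ((le_max_left _ _).trans ((le_iSup₂ (f := fun a _ =>
      max (w a - idealWeight z k a) (idealWeight z k a - w a)) a ha).trans hw))
  have hw2 : ∀ a ∈ blocks 𝒳 b (k + 1), idealWeight z k a ≤ w a + ENNReal.ofReal (b * ε) := by
    intro a ha
    exact tsub_le_iff_left.1 ((le_max_right _ _).trans ((le_iSup₂ (f := fun a _ =>
      max (w a - idealWeight z k a) (idealWeight z k a - w a)) a ha).trans hw))
  have hmin := hsol.2 z hx
  unfold amepCost at hmin
  rw [← Matrix.mulVec_sub, ← Matrix.mulVec_sub] at hmin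
  -- The factor `4^b` in `lam` cancels the squared quantization error; `32 = 4 * 8`.
  have hquad : lam / (n : ℝ) ^ 2 * ‖WithLp.toLp 2 (A *ᵥ (z - x))‖ ^ 2 ≤ 32 * m / n := by
    have h1 : ‖WithLp.toLp 2 (A *ᵥ (z - x))‖ ^ 2 ≤ 8 * m * (n / 4 ^ b) :=
      hup.trans (mul_le_mul_of_nonneg_left (normSq_quantize_sub_le b x) (by positivity))
    calc lam / (n : ℝ) ^ 2 * ‖WithLp.toLp 2 (A *ᵥ (z - x))‖ ^ 2
        ≤ 4 * 4 ^ b / (n : ℝ) ^ 2 * (8 * m * (n / 4 ^ b)) := by gcongr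
      _ = (32 * m / n : ℝ) := by field_simp; norm_num
  set R : ℝ := b * (d + ε / 2) + b * ε + 32 * m / n with hR
  have htot : weightCost 𝒳 b k w xhat
      + ENNReal.ofReal (lam / (n : ℝ) ^ 2 * ‖WithLp.toLp 2 (A *ᵥ (xhat - x))‖ ^ 2)
        ≤ ENNReal.ofReal R := by
    refine hmin.trans ?_
    rw [hR, ENNReal.ofReal_add (by positivity) (by positivity),
      ENNReal.ofReal_add (by positivity) (by positivity)]
    refine add_le_add ?_ (ENNReal.ofReal_le_ofReal hquad)
    exact (weightCost_le_add hw1 hx).trans (add_le_add_left hcost _)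
  have hxhat : weightCost 𝒳 b k (idealWeight z k) xhat
      ≤ ENNReal.ofReal (b * (d + 5 / 2 * ε) + 32 * m / n) := by
    refine (weightCost_le_add hw2 hsol.1).trans ?_
    refine (add_le_add_left (le_self_add.trans htot) _).trans ?_
    rw [← ENNReal.ofReal_add (by positivity) (by positivity)]
    refine ENNReal.ofReal_le_ofReal (le_of_eq ?_)
    rw [hR]
    ring
  have h5 := hlow xhat hsol.1 hxhat
  have h6 := (ENNReal.ofReal_le_ofReal_iff (by positivity)).1 (le_add_self.trans htot)
  have hnorm : ‖WithLp.toLp 2 (x - xhat)‖ = ‖WithLp.toLp 2 (xhat - x)‖ := by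
    rw [← neg_sub xhat x, WithLp.toLp_neg, norm_neg]
  rw [hnorm]
  set D := ‖WithLp.toLp 2 (xhat - x)‖ ^ 2 with hD
  have h7 : 4 ^ b / (n : ℝ) ^ 2 * (τ * m * D) ≤ R := by
    refine le_trans ?_ h6
    gcongr
  have h8 : R * n ≤ (b + 32) * m := by
    have e : R * n = b * ((d + 3 / 2 * ε) * n) + 32 * m := by rw [hR]; field_simp; ring
    have h9 : (d + 3 / 2 * ε) * n ≤ m := le_trans
      (mul_le_mul_of_nonneg_right (by linarith) hn'.le) hm
    rw [e]
    linarith [mul_le_mul_of_nonneg_left h9 (Nat.cast_nonneg (α := ℝ) b)]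
  rw [div_le_div_iff₀ hn' (by positivity)]
  have h10 : 4 ^ b / (n : ℝ) ^ 2 * (τ * m * D) * n * n ≤ R * n * n := by gcongr
  have h11 : R * n * n ≤ (b + 32) * m * n := by gcongr
  have h12 : 4 ^ b / (n : ℝ) ^ 2 * (τ * m * D) * n * n = m * (D * (4 ^ b * τ)) := by field_simp
  have h13 : m * (D * (4 ^ b * τ)) ≤ m * ((b + 32) * n) := by
    rw [← h12]; linarith
  exact le_of_mul_le_mul_left h13 hm'

/-! ### The measurement matrix on the candidate sequences -/

/-- Quantization factors through the discrete space `ℤⁿ`, so `p` needs no regularity. This handles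
the ideal weights of the quantized samples. -/
theorem measurableSet_quantize_pred (b n : ℕ) (p : (Fin n → ℝ) → Prop) :
    MeasurableSet {x : Fin n → ℝ | p fun i => quantize b (x i)} := by
  have h1 : Measurable fun (x : Fin n → ℝ) (i : Fin n) => ⌊(2 : ℝ) ^ b * x i⌋ := by fun_prop
  have h2 : MeasurableSet {z : Fin n → ℤ | p fun i => (z i : ℝ) / 2 ^ b} := .of_discrete
  have h3 := h1 h2
  have h4 : quantize b = fun x => (⌊(2 : ℝ) ^ b * x⌋ : ℝ) / 2 ^ b := funext (quantize_eq_floor b)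
  rw [h4]
  exact h3

section Measurements

variable {Ω : Type*} [MeasurableSpace Ω] {P : Measure Ω} [IsProbabilityMeasure P] {m n : ℕ}
  {A : Ω → Matrix (Fin m) (Fin n) ℝ} {U : Ω → Fin n → ℝ}

theorem measurable_normSq_toLp {α ι : Type*} [Fintype ι] [MeasurableSpace α] {f : α → ι → ℝ}
    (hf : Measurable f) : Measurable fun x => ‖WithLp.toLp 2 (f x)‖ ^ 2 := by
  simp_rw [normSq_toLp]
  fun_prop

theorem measurable_mulVec_uncurry {β : Type*} [MeasurableSpace β] {f : β → Fin n → ℝ}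
    (hf : Measurable f) :
    Measurable fun q : (Fin m × Fin n → ℝ) × β =>
      (Matrix.of fun i j => q.1 (i, j)) *ᵥ f q.2 := by
  refine measurable_pi_lambda _ fun i => ?_
  simp only [Matrix.mulVec, dotProduct, Matrix.of_apply]
  fun_prop

/-- For a matrix with independent entries that is independent of `U`, a bound that holds for all
fixed values of `U` holds for the random one. -/
theorem measure_matrix_le {R : Matrix (Fin m) (Fin n) ℝ → (Fin n → ℝ) → Prop}
    (hlaw : ∀ i j, HasLaw (fun ω => A ω i j) (gaussianReal 0 1) P)
    (hU : Measurable U) (hAU : IndepFun (fun ω (p : Fin m × Fin n) => A ω p.1 p.2) U P)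
    (hR : MeasurableSet {q : (Fin m × Fin n → ℝ) × (Fin n → ℝ) |
      R (Matrix.of fun i j => q.1 (i, j)) q.2}) {c : ℝ} (hc : ∀ x, P.real {ω | R (A ω) x} ≤ c) :
    P {ω | R (A ω) (U ω)} ≤ ENNReal.ofReal c := by
  have hA : AEMeasurable (fun ω (p : Fin m × Fin n) => A ω p.1 p.2) P :=
    aemeasurable_pi_lambda _ fun p => (hlaw p.1 p.2).aemeasurable
  refine measure_mem_le_of_forall_section hA hU.aemeasurable hAU hR fun x => ?_
  have h := ENNReal.ofReal_le_ofReal (hc x)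
  rw [ofReal_measureReal] at h
  exact h

theorem measure_lt_normSq_mulVec_quantize_le
    (hlaw : ∀ i j, HasLaw (fun ω => A ω i j) (gaussianReal 0 1) P)
    (hindep : iIndepFun (fun (p : Fin m × Fin n) ω => A ω p.1 p.2) P)
    (hU : Measurable U) (hAU : IndepFun (fun ω (p : Fin m × Fin n) => A ω p.1 p.2) U P) (b : ℕ) :
    P {ω | 8 * m * ‖WithLp.toLp 2 ((fun i => quantize b (U ω i)) - U ω)‖ ^ 2
        < ‖WithLp.toLp 2 (A ω *ᵥ ((fun i => quantize b (U ω i)) - U ω))‖ ^ 2}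
      ≤ ENNReal.ofReal ((1 / 2) ^ m) := by
  have hf : Measurable fun x : Fin n → ℝ => (fun i => quantize b (x i)) - x := by
    refine Measurable.sub (measurable_pi_lambda _ fun i => ?_) measurable_id
    exact (measurable_quantize b).comp (measurable_pi_apply i)
  refine measure_matrix_le (A := A) (U := U)
    (R := fun a x => 8 * m * ‖WithLp.toLp 2 ((fun i => quantize b (x i)) - x)‖ ^ 2
      < ‖WithLp.toLp 2 (a *ᵥ ((fun i => quantize b (x i)) - x))‖ ^ 2) hlaw hU hAU ?_
    fun x => measureReal_lt_normSq_mulVec_le hlaw hindep _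
  have h1 : Measurable fun q : (Fin m × Fin n → ℝ) × (Fin n → ℝ) =>
      8 * m * ‖WithLp.toLp 2 ((fun i => quantize b (q.2 i)) - q.2)‖ ^ 2 :=
    (measurable_normSq_toLp (hf.comp measurable_snd)).const_mul _
  have h2 : Measurable fun q : (Fin m × Fin n → ℝ) × (Fin n → ℝ) =>
      ‖WithLp.toLp 2 ((Matrix.of fun i j => q.1 (i, j)) *ᵥ
        ((fun i => quantize b (q.2 i)) - q.2))‖ ^ 2 :=
    measurable_normSq_toLp (measurable_mulVec_uncurry hf)
  exact measurableSet_lt h1 h2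

/-- The candidate set depends on the matrix only through nothing but `U`: once `U` is fixed it is a
deterministic finite set, so a union bound applies, and independence carries the bound over to
random `U`. -/
theorem measure_exists_normSq_mulVec_lt_le
    (hlaw : ∀ i j, HasLaw (fun ω => A ω i j) (gaussianReal 0 1) P)
    (hindep : iIndepFun (fun (p : Fin m × Fin n) ω => A ω p.1 p.2) P)
    (hU : Measurable U) (hAU : IndepFun (fun ω (p : Fin m × Fin n) => A ω p.1 p.2) U P)
    {𝒳 : Set ℝ} {b k : ℕ} {S : Finset ℝ} (hS : quantizedSet 𝒳 b = S) (hk : k + 1 < n)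
    {τ : ℝ} (hτ : 0 < τ) {B : ℝ} (hB : 0 ≤ B) :
    P {ω | ∃ u ∈ blocks 𝒳 b n,
        weightCost 𝒳 b k (idealWeight (fun i => quantize b (U ω i)) k) u ≤ ENNReal.ofReal B ∧
        ‖WithLp.toLp 2 (A ω *ᵥ (u - U ω))‖ ^ 2 < τ * m * ‖WithLp.toLp 2 (u - U ω)‖ ^ 2}
      ≤ ENNReal.ofReal ((S.card : ℝ) ^ (k + 1) * 2 ^ (n * B) * √(Real.exp 1 * τ) ^ m) := by
  classical
  have hblocks : ∀ u : Fin n → ℝ, u ∈ blocks 𝒳 b n ↔ u ∈ Fintype.piFinset fun _ : Fin n => S := by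
    intro u
    rw [Fintype.mem_piFinset]
    unfold blocks
    simp [hS]
  refine measure_matrix_le (A := A) (U := U)
    (R := fun a x => ∃ u ∈ blocks 𝒳 b n,
      weightCost 𝒳 b k (idealWeight (fun i => quantize b (x i)) k) u ≤ ENNReal.ofReal B ∧
      ‖WithLp.toLp 2 (a *ᵥ (u - x))‖ ^ 2 < τ * m * ‖WithLp.toLp 2 (u - x)‖ ^ 2) hlaw hU hAU ?_
    fun x => ?_
  · have hT : {q : (Fin m × Fin n → ℝ) × (Fin n → ℝ) | ∃ u ∈ blocks 𝒳 b n,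
        weightCost 𝒳 b k (idealWeight (fun i => quantize b (q.2 i)) k) u ≤ ENNReal.ofReal B ∧
        ‖WithLp.toLp 2 ((Matrix.of fun i j => q.1 (i, j)) *ᵥ (u - q.2))‖ ^ 2
          < τ * m * ‖WithLp.toLp 2 (u - q.2)‖ ^ 2}
        = ⋃ u ∈ Fintype.piFinset fun _ : Fin n => S, (Prod.snd ⁻¹' {x |
            weightCost 𝒳 b k (idealWeight (fun i => quantize b (x i)) k) u ≤ ENNReal.ofReal B})
          ∩ {q : (Fin m × Fin n → ℝ) × (Fin n → ℝ) |
              ‖WithLp.toLp 2 ((Matrix.of fun i j => q.1 (i, j)) *ᵥ (u - q.2))‖ ^ 2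
                < τ * m * ‖WithLp.toLp 2 (u - q.2)‖ ^ 2} := by
      ext q
      simp only [hblocks, Set.mem_ofPred_eq, Set.mem_iUnion, Set.mem_inter_iff, Set.mem_preimage,
        exists_prop]
    rw [hT]
    refine Finset.measurableSet_biUnion _ fun u _ => MeasurableSet.inter ?_ ?_
    · exact measurable_snd (measurableSet_quantize_pred b n fun z =>
        weightCost 𝒳 b k (idealWeight z k) u ≤ ENNReal.ofReal B)
    · have hf : Measurable fun x : Fin n → ℝ => u - x := by fun_prop
      have h1 : Measurable fun q : (Fin m × Fin n → ℝ) × (Fin n → ℝ) =>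
          τ * m * ‖WithLp.toLp 2 (u - q.2)‖ ^ 2 :=
        (measurable_normSq_toLp (hf.comp measurable_snd)).const_mul _
      have h2 : Measurable fun q : (Fin m × Fin n → ℝ) × (Fin n → ℝ) =>
          ‖WithLp.toLp 2 ((Matrix.of fun i j => q.1 (i, j)) *ᵥ (u - q.2))‖ ^ 2 :=
        measurable_normSq_toLp (measurable_mulVec_uncurry hf)
      exact measurableSet_lt h2 h1
  · set C := (Fintype.piFinset fun _ : Fin n => S).filter fun u =>
      weightCost 𝒳 b k (idealWeight (fun i => quantize b (x i)) k) u ≤ ENNReal.ofReal B with hC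
    have hcard := card_weightCost_le hS hk (fun i => quantize b (x i)) hB C fun u hu =>
      ⟨(hblocks u).2 (Finset.mem_filter.1 hu).1, (Finset.mem_filter.1 hu).2⟩
    have hsub : {ω | ∃ u ∈ blocks 𝒳 b n,
        weightCost 𝒳 b k (idealWeight (fun i => quantize b (x i)) k) u ≤ ENNReal.ofReal B ∧
        ‖WithLp.toLp 2 (A ω *ᵥ (u - x))‖ ^ 2 < τ * m * ‖WithLp.toLp 2 (u - x)‖ ^ 2}
        ⊆ ⋃ u ∈ C, {ω | ‖WithLp.toLp 2 (A ω *ᵥ (u - x))‖ ^ 2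
          < τ * m * ‖WithLp.toLp 2 (u - x)‖ ^ 2} := by
      rintro ω ⟨u, hu1, hu2, hu3⟩
      simp only [Set.mem_iUnion, exists_prop]
      exact ⟨u, Finset.mem_filter.2 ⟨(hblocks u).1 hu1, hu2⟩, hu3⟩
    calc _ ≤ P.real (⋃ u ∈ C, {ω | ‖WithLp.toLp 2 (A ω *ᵥ (u - x))‖ ^ 2
          < τ * m * ‖WithLp.toLp 2 (u - x)‖ ^ 2}) := measureReal_mono hsub (measure_ne_top _ _)
      _ ≤ ∑ u ∈ C, P.real {ω | ‖WithLp.toLp 2 (A ω *ᵥ (u - x))‖ ^ 2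
          < τ * m * ‖WithLp.toLp 2 (u - x)‖ ^ 2} := measureReal_biUnion_finset_le _ _
      _ ≤ ∑ _u ∈ C, √(Real.exp 1 * τ) ^ m :=
          Finset.sum_le_sum fun u _ => measureReal_normSq_mulVec_lt_le hlaw hindep _ hτ
      _ = C.card * √(Real.exp 1 * τ) ^ m := by rw [Finset.sum_const, nsmul_eq_mul]
      _ ≤ _ := by gcongr

end Measurements

/-! ### Asymptotics of the parameters -/

theorem tendsto_bitLevel {r : ℝ} (hr : 0 < r) : Tendsto (bitLevel r) atTop atTop := by
  have h := Real.tendsto_logb_atTop (b := 2) (by norm_num)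
  exact tendsto_nat_floor_atTop.comp
    ((h.comp (h.comp tendsto_natCast_atTop_atTop)).const_mul_atTop hr)

/-- `regCoeff` is `4` to the power `r log log n`; rounding this exponent down to `bitLevel` loses a
factor of at most `4`. -/
theorem eventually_regCoeff_bounds {r : ℝ} (hr : 0 < r) :
    ∀ᶠ n : ℕ in atTop, 4 ^ bitLevel r n ≤ regCoeff r n ∧
      regCoeff r n ≤ 4 * 4 ^ bitLevel r n := by
  have h := (Real.tendsto_logb_atTop (b := 2) (by norm_num)).comp
    (tendsto_natCast_atTop_atTop (R := ℝ))
  filter_upwards [h.eventually_ge_atTop 1] with n hn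
  simp only [Function.comp_apply] at hn
  set L := Real.logb 2 n with hL
  have hL0 : 0 < L := by linarith
  have hLL : 0 ≤ Real.logb 2 L := Real.logb_nonneg (by norm_num) hn
  have h1 : regCoeff r n = 4 ^ (r * Real.logb 2 L) := by
    unfold regCoeff
    rw [← hL]
    nth_rewrite 1 [← Real.rpow_logb (b := 2) (by norm_num) (by norm_num) hL0]
    rw [← Real.rpow_mul (by norm_num), show (4 : ℝ) = 2 ^ (2 : ℝ) by norm_num,
      ← Real.rpow_mul (by norm_num)]
    congr 1
    ring
  have h2 : (bitLevel r n : ℝ) ≤ r * Real.logb 2 L := Nat.floor_le (by positivity)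
  have h3 : r * Real.logb 2 L ≤ bitLevel r n + 1 := (Nat.lt_floor_add_one _).le
  rw [h1, ← Real.rpow_natCast]
  constructor
  · exact Real.rpow_le_rpow_of_exponent_le (by norm_num) h2
  · rw [mul_comm 4, ← Real.rpow_add_one (by norm_num)]
    exact Real.rpow_le_rpow_of_exponent_le (by norm_num) h3

theorem isLittleO_natCast_of_isLittleO_log_div {k : ℕ → ℕ}
    (hk : (fun n : ℕ => (k n : ℝ)) =o[atTop]
      fun n : ℕ => Real.logb 2 n / Real.logb 2 (Real.logb 2 n)) :
    (fun n : ℕ => (k n : ℝ)) =o[atTop] fun n : ℕ => (n : ℝ) := by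
  refine hk.trans_isBigO (IsBigO.of_bound 2 ?_)
  have h := (Real.tendsto_logb_atTop (b := 2) (by norm_num)).comp
    (tendsto_natCast_atTop_atTop (R := ℝ))
  have h' := (Real.tendsto_logb_atTop (b := 2) (by norm_num)).comp h
  filter_upwards [h.eventually_ge_atTop 1, h'.eventually_ge_atTop 1] with n hn hn'
  simp only [Function.comp_apply] at hn hn'
  rw [Real.norm_of_nonneg (by positivity), Real.norm_of_nonneg (by positivity)]
  have h1 : Real.logb 2 n / Real.logb 2 (Real.logb 2 n) ≤ Real.logb 2 n :=
    div_le_self (by linarith) hn'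
  refine h1.trans ?_
  unfold Real.logb
  have h2 := Real.log_le_self (Nat.cast_nonneg (α := ℝ) n)
  have h3 := Real.log_two_gt_d9
  rw [div_le_iff₀ (by linarith)]
  nlinarith [Nat.cast_nonneg (α := ℝ) n]

theorem tendsto_sub_succ_of_isLittleO {k : ℕ → ℕ}
    (hk : (fun n : ℕ => (k n : ℝ)) =o[atTop] fun n : ℕ => (n : ℝ)) :
    Tendsto (fun n => n - (k n + 1)) atTop atTop := by
  have h1 : Tendsto (fun n : ℕ => n / 4) atTop atTop := Nat.tendsto_div_const_atTop (by norm_num)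
  refine tendsto_atTop_mono' _ ?_ h1
  filter_upwards [hk.bound (show (0 : ℝ) < 1 / 4 by norm_num), eventually_ge_atTop 4] with n hn hn4
  rw [Real.norm_of_nonneg (by positivity), Real.norm_of_nonneg (by positivity)] at hn
  have h2 : 4 * k n ≤ n := by
    have : (4 * k n : ℝ) ≤ n := by linarith
    exact_mod_cast this
  omega

/-- The union bound of `measure_exists_normSq_mulVec_lt_le`, with `τ` below the critical value. -/
theorem unionBound_le {b k m n c M : ℕ} {d ε δ : ℝ} (hδ : 0 < δ) (hM : 0 < M)
    (hc : c ≤ M * 2 ^ b) (hb : 1 ≤ b) (hn : 0 < n)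
    (hk : (k + 1) * (1 + Real.logb 2 M) ≤ n * (ε / 2))
    (hm : (1 + δ) * (d + 3 * ε) * n ≤ m)
    (hbδ : 34 ≤ b * (1 / (1 + δ / 2) - 1 / (1 + δ))) :
    (c : ℝ) ^ (k + 1) * 2 ^ (n * (b * (d + 5 / 2 * ε) + 32 * m / n))
        * √(Real.exp 1 * (2 : ℝ) ^ (-(2 * b / (1 + δ / 2)))) ^ m ≤ (1 / 2) ^ m := by
  have hn' : (0 : ℝ) < n := by exact_mod_cast hn
  have hM1 : (1 : ℝ) ≤ M := by exact_mod_cast hM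
  have hb1 : (1 : ℝ) ≤ b := by exact_mod_cast hb
  have hlogM : 0 ≤ Real.logb 2 M := Real.logb_nonneg (by norm_num) hM1
  have h1 : (c : ℝ) ^ (k + 1) ≤ 2 ^ (n * b * (ε / 2)) := by
    have e1 : (c : ℝ) ≤ 2 ^ (b * (1 + Real.logb 2 M)) := by
      have e2 : (c : ℝ) ≤ M * 2 ^ b := by exact_mod_cast hc
      refine e2.trans ?_
      nth_rewrite 1 [← Real.rpow_logb (b := 2) (x := (M : ℝ)) (by norm_num) (by norm_num)
        (by linarith)]
      rw [← Real.rpow_natCast, ← Real.rpow_add (by norm_num)]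
      refine Real.rpow_le_rpow_of_exponent_le (by norm_num) ?_
      nlinarith
    calc (c : ℝ) ^ (k + 1) ≤ ((2 : ℝ) ^ (b * (1 + Real.logb 2 M))) ^ (k + 1) := by gcongr
      _ = 2 ^ (b * (1 + Real.logb 2 M) * ((k + 1 : ℕ) : ℝ)) := by
          rw [← Real.rpow_natCast, ← Real.rpow_mul (by norm_num)]
      _ ≤ 2 ^ (n * b * (ε / 2)) := by
          refine Real.rpow_le_rpow_of_exponent_le (by norm_num) ?_
          push_cast
          nlinarith
  have h2 : √(Real.exp 1 * (2 : ℝ) ^ (-(2 * b / (1 + δ / 2))))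
      ≤ 2 ^ (1 - b / (1 + δ / 2) : ℝ) := by
    rw [Real.sqrt_le_left (by positivity), ← Real.rpow_natCast, ← Real.rpow_mul (by norm_num)]
    have e1 : (1 - b / (1 + δ / 2)) * ((2 : ℕ) : ℝ) = 2 + -(2 * b / (1 + δ / 2)) := by
      push_cast; ring
    rw [e1, Real.rpow_add (by norm_num)]
    gcongr
    have := Real.exp_one_lt_d9
    norm_num
    linarith
  have h3 : √(Real.exp 1 * (2 : ℝ) ^ (-(2 * b / (1 + δ / 2)))) ^ m
      ≤ 2 ^ ((1 - b / (1 + δ / 2)) * m : ℝ) := by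
    rw [Real.rpow_mul (by norm_num), Real.rpow_natCast]
    gcongr
  have h4 : ((1 : ℝ) / 2) ^ m = 2 ^ (-(m : ℝ)) := by
    rw [Real.rpow_neg (by norm_num), Real.rpow_natCast, one_div, inv_pow]
  rw [h4]
  calc _ ≤ (2 : ℝ) ^ (n * b * (ε / 2)) * 2 ^ (n * (b * (d + 5 / 2 * ε) + 32 * m / n))
        * 2 ^ ((1 - b / (1 + δ / 2)) * m : ℝ) := by gcongr
    _ = 2 ^ (n * b * (ε / 2) + n * (b * (d + 5 / 2 * ε) + 32 * m / n)
        + (1 - b / (1 + δ / 2)) * m : ℝ) := by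
      rw [← Real.rpow_add (by norm_num), ← Real.rpow_add (by norm_num)]
    _ ≤ 2 ^ (-(m : ℝ)) := by
      refine Real.rpow_le_rpow_of_exponent_le (by norm_num) ?_
      -- The uncoded symbols use up the remaining `ε/2` of the margin `3ε`.
      have e1 : n * b * (ε / 2) + n * (b * (d + 5 / 2 * ε) + 32 * m / n)
          = b * ((d + 3 * ε) * n) + 32 * m := by field_simp; ring
      have e2 : (d + 3 * ε) * n ≤ m * (1 / (1 + δ)) := by
        rw [mul_one_div, le_div_iff₀ (by positivity)]
        linarith
      have e3 : b * ((d + 3 * ε) * n) ≤ b * (m * (1 / (1 + δ))) := by gcongr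
      -- `34 = 32 + 1 + 1`: the quadratic allowance `32m`, the `m` from bounding `√e` by `2`, and
      -- the target `2^(-m)`.
      have e4 := mul_le_mul_of_nonneg_right hbδ (Nat.cast_nonneg (α := ℝ) m)
      have e5 : (1 - b / (1 + δ / 2)) * (m : ℝ) = m - b * (1 / (1 + δ / 2)) * m := by ring
      rw [e1, e5]
      nlinarith

theorem tendsto_errorBound {b : ℕ → ℕ} (hb : Tendsto b atTop atTop) {δ : ℝ} (hδ : 0 < δ) :
    Tendsto (fun n => ((b n : ℝ) + 32) / (4 ^ b n * (2 : ℝ) ^ (-(2 * b n / (1 + δ / 2)))))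
      atTop (𝓝 0) := by
  -- The denominator is `c^(-b)` with `c < 1`, so it beats the linear numerator.
  set c : ℝ := 2 ^ (-(2 * (1 - 1 / (1 + δ / 2)))) with hc
  have hc0 : 0 < c := by positivity
  have hc1 : c < 1 := by
    refine Real.rpow_lt_one_of_one_lt_of_neg (by norm_num) ?_
    have : 1 / (1 + δ / 2) < 1 := by
      rw [div_lt_one (by positivity)]
      linarith
    linarith
  have h1 : Tendsto (fun n : ℕ => (n : ℝ) * c ^ n + 32 * c ^ n) atTop (𝓝 0) := by
    have := (tendsto_self_mul_const_pow_of_lt_one hc0.le hc1).add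
      ((tendsto_pow_atTop_nhds_zero_of_lt_one hc0.le hc1).const_mul 32)
    simpa using this
  refine (h1.comp hb).congr fun n => ?_
  have h2 : c ^ b n * (4 ^ b n * (2 : ℝ) ^ (-(2 * b n / (1 + δ / 2)))) = 1 := by
    rw [hc, ← Real.rpow_natCast, ← Real.rpow_mul (by norm_num), ← Real.rpow_natCast (4 : ℝ),
      show (4 : ℝ) = 2 ^ (2 : ℝ) by norm_num, ← Real.rpow_mul (by norm_num),
      ← Real.rpow_add (by norm_num), ← Real.rpow_add (by norm_num)]
    rw [show -(2 * (1 - 1 / (1 + δ / 2))) * (b n : ℝ) + (2 * b n + -(2 * b n / (1 + δ / 2))) = 0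
      by ring]
    simp
  simp only [Function.comp_apply]
  rw [eq_div_iff (by positivity), ← add_mul, mul_assoc, h2, mul_one]

end CSens

/-! ### Assembly of the exceptional events -/

theorem mainTheorem4 {Ω : Type*} [MeasurableSpace Ω] (P : Measure Ω) [IsProbabilityMeasure P]
    -- the source: a stationary Ψ*-mixing process with values in a bounded alphabet
    (𝒳 : Set ℝ) (h𝒳 : Bornology.IsBounded 𝒳)
    (X : ℕ → Ω → ℝ) (hXmeas : ∀ i, Measurable (X i)) (hX𝒳 : ∀ i, ∀ᵐ ω ∂P, X i ω ∈ 𝒳)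
    (hXstat : CSens.IsStationary P X) (hXmix : CSens.IsPsiStarMixing P X)
    -- the parameters
    (r : ℝ) (hr : 1 < r) (δ : ℝ) (hδ : 0 < δ) (εw : ℝ) (hεw : 0 < εw)
    (k : ℕ → ℕ) (hk : Tendsto k atTop atTop)
    (hk' : (fun n : ℕ => (k n : ℝ)) =o[atTop]
      fun n : ℕ => Real.logb 2 n / Real.logb 2 (Real.logb 2 n))
    (m : ℕ → ℕ)
    (hm : ∀ n : ℕ, ENNReal.ofReal (1 + δ) * (CSens.upperID P X + 3 * ENNReal.ofReal εw) * (n : ℝ≥0∞)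
      ≤ (m n : ℝ≥0∞))
    -- the measurement matrices: i.i.d. standard Gaussian entries, independent of the source
    (A : (n : ℕ) → Ω → Matrix (Fin (m n)) (Fin n) ℝ)
    (hAlaw : ∀ n i j, HasLaw (fun ω => A n ω i j) (gaussianReal 0 1) P)
    (hAindep : ∀ n, iIndepFun (fun (p : Fin (m n) × Fin n) ω => A n ω p.1 p.2) P)
    (hAX : ∀ n, IndepFun (fun ω (p : Fin (m n) × Fin n) => A n ω p.1 p.2)
      (CSens.samples X n) P)
    -- the (random) weights
    (W : (n : ℕ) → Ω → (Fin (k n + 1) → ℝ) → ℝ≥0∞)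
    (hW : Tendsto (fun n : ℕ => P {ω | ENNReal.ofReal εw <
        CSens.weightDist (CSens.blocks 𝒳 (CSens.bitLevel r n) (k n + 1)) (W n ω)
          (CSens.idealWeight
            (fun i => CSens.quantize (CSens.bitLevel r n) (CSens.samples X n ω i)) (k n))
        / (CSens.bitLevel r n : ℝ≥0∞)}) atTop (𝓝 0))
    -- the reconstructions: minimizers of the A-MEP cost for the measurements `A X^n`
    (Xhat : (n : ℕ) → Ω → Fin n → ℝ)
    (hXhat : ∀ n, ∀ᵐ ω ∂P, CSens.IsAMEPSolution 𝒳 (CSens.bitLevel r n) (k n) (W n ω)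
      (CSens.regCoeff r n) (A n ω) (A n ω *ᵥ CSens.samples X n ω) (Xhat n ω)) :
    TendstoInMeasure P
      (fun (n : ℕ) ω => 1 / √(n : ℝ) * ‖WithLp.toLp 2 (CSens.samples X n ω - Xhat n ω)‖)
      atTop (fun _ => 0) := by
  set d : ℝ := (CSens.upperID P X).toReal with hd
  have hd0 : 0 ≤ d := ENNReal.toReal_nonneg
  -- An infinite dimension would force `m 1 = ∞`.
  have hdtop : CSens.upperID P X ≠ ∞ := by
    intro htop
    have h1 := hm 1
    rw [htop, top_add, ENNReal.mul_top (by simp; linarith), Nat.cast_one, mul_one] at h1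
    exact ENNReal.natCast_ne_top _ (top_le_iff.1 h1)
  have hmR : ∀ n : ℕ, (1 + δ) * (d + 3 * εw) * n ≤ m n := by
    intro n
    have h1 := hm n
    rw [← ENNReal.ofReal_toReal hdtop, ← hd, ← ENNReal.ofReal_ofNat, ← ENNReal.ofReal_mul (by simp),
      ← ENNReal.ofReal_add hd0 (by positivity), ← ENNReal.ofReal_mul (by positivity),
      ← ENNReal.ofReal_natCast, ← ENNReal.ofReal_natCast, ← ENNReal.ofReal_mul (by positivity),
      ENNReal.ofReal_le_ofReal_iff (by positivity)] at h1
    exact h1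
  have hmtop : Tendsto (fun n => (m n : ℝ)) atTop atTop :=
    tendsto_atTop_mono hmR
      (tendsto_natCast_atTop_atTop.const_mul_atTop (show 0 < (1 + δ) * (d + 3 * εw) by positivity))
  have hr0 : 0 < r := by linarith
  have hb := CSens.tendsto_bitLevel hr0
  have hkn := CSens.isLittleO_natCast_of_isLittleO_log_div hk'
  have hN := CSens.tendsto_sub_succ_of_isLittleO hkn
  obtain ⟨M, hM0, hM⟩ := CSens.exists_finset_quantizedSet h𝒳
  choose S hS hScard using hM
  set b : ℕ → ℕ := CSens.bitLevel r with hbdef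
  -- Any exponent strictly between `2b/(1 + δ)` and `2b` would serve, up to constants: `τ` must be
  -- small for the union bound, while `4^b τ` must outgrow `b`.
  set τ : ℕ → ℝ := fun n => (2 : ℝ) ^ (-(2 * b n / (1 + δ / 2))) with hτ
  have hτ0 : ∀ n, 0 < τ n := fun n => by positivity
  have hX𝒳' : ∀ᵐ ω ∂P, ∀ i, X i ω ∈ 𝒳 := ae_all_iff.2 hX𝒳
  have hsamp : ∀ n, Measurable (CSens.samples X n) := fun n =>
    measurable_pi_lambda _ fun i => hXmeas i
  -- the exceptional events
  set E1 : ℕ → Set Ω := fun n => {ω | ENNReal.ofReal εw <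
        CSens.weightDist (CSens.blocks 𝒳 (b n) (k n + 1)) (W n ω)
          (CSens.idealWeight (fun i => CSens.quantize (b n) (CSens.samples X n ω i)) (k n))
        / (b n : ℝ≥0∞)} with hE1
  set E2 : ℕ → Set Ω := fun n => {ω | ¬ CSens.weightCost 𝒳 (b n) (k n)
        (CSens.idealWeight (fun i => CSens.quantize (b n) (CSens.samples X n ω i)) (k n))
        (fun i => CSens.quantize (b n) (CSens.samples X n ω i))
          ≤ ENNReal.ofReal (b n * (d + εw / 2))} with hE2
  set E3 : ℕ → Set Ω := fun n => {ω | 8 * m n * ‖WithLp.toLp 2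
          ((fun i => CSens.quantize (b n) (CSens.samples X n ω i)) - CSens.samples X n ω)‖ ^ 2
        < ‖WithLp.toLp 2 (A n ω *ᵥ ((fun i => CSens.quantize (b n) (CSens.samples X n ω i))
          - CSens.samples X n ω))‖ ^ 2} with hE3
  set E4 : ℕ → Set Ω := fun n => {ω | ∃ u ∈ CSens.blocks 𝒳 (b n) n,
        CSens.weightCost 𝒳 (b n) (k n)
          (CSens.idealWeight (fun i => CSens.quantize (b n) (CSens.samples X n ω i)) (k n)) u
            ≤ ENNReal.ofReal (b n * (d + 5 / 2 * εw) + 32 * m n / n) ∧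
        ‖WithLp.toLp 2 (A n ω *ᵥ (u - CSens.samples X n ω))‖ ^ 2
          < τ n * m n * ‖WithLp.toLp 2 (u - CSens.samples X n ω)‖ ^ 2} with hE4
  have hhalf : Tendsto (fun n => ENNReal.ofReal ((1 / 2 : ℝ) ^ m n)) atTop (𝓝 0) := by
    have h1 : Tendsto (fun n => (1 / 2 : ℝ) ^ m n) atTop (𝓝 0) :=
      (tendsto_pow_atTop_nhds_zero_of_lt_one (by norm_num) (by norm_num)).comp
        (tendsto_natCast_atTop_iff.1 hmtop)
    simpa using ENNReal.tendsto_ofReal h1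
  have hP2 : Tendsto (fun n => P (E2 n)) atTop (𝓝 0) :=
    CSens.tendsto_measure_weightCost_samples hXmeas hX𝒳 h𝒳 hXstat hXmix hdtop hb hk hN
      (show 0 < εw / 2 by positivity)
  have hP3 : Tendsto (fun n => P (E3 n)) atTop (𝓝 0) :=
    tendsto_of_tendsto_of_tendsto_of_le_of_le tendsto_const_nhds hhalf (fun _ => zero_le)
      fun n => CSens.measure_lt_normSq_mulVec_quantize_le (hAlaw n) (hAindep n) (hsamp n) (hAX n) _
  have hP4 : Tendsto (fun n => P (E4 n)) atTop (𝓝 0) := by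
    refine tendsto_of_tendsto_of_tendsto_of_le_of_le' tendsto_const_nhds hhalf
      (Eventually.of_forall fun _ => zero_le) ?_
    have hM1 : (1 : ℝ) ≤ M := by exact_mod_cast hM0
    have hlogM : 0 ≤ Real.logb 2 M := Real.logb_nonneg (by norm_num) hM1
    set c : ℝ := εw / 2 / (1 + Real.logb 2 M) with hc
    have hc0 : 0 < c := by positivity
    have hκ : 0 < 1 / (1 + δ / 2) - 1 / (1 + δ) := by
      rw [sub_pos]
      exact one_div_lt_one_div_of_lt (by positivity) (by linarith)
    have hbκ := (tendsto_natCast_atTop_atTop (R := ℝ).comp hb).atTop_mul_const hκ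
    filter_upwards [hkn.bound (show (0 : ℝ) < c / 2 by positivity), hb.eventually_ge_atTop 1,
      hN.eventually_gt_atTop 0, hbκ.eventually_ge_atTop 34,
      (tendsto_natCast_atTop_atTop (R := ℝ)).eventually_ge_atTop (2 / c)] with n h1 h2 h3 h4 h5
    have hn : 0 < n := by omega
    refine (CSens.measure_exists_normSq_mulVec_lt_le (hAlaw n) (hAindep n) (hsamp n) (hAX n)
      (hS (b n)) (by omega) (hτ0 n) (by positivity)).trans (ENNReal.ofReal_le_ofReal ?_)
    refine CSens.unionBound_le hδ hM0 (hScard (b n)) h2 hn ?_ (hmR n) h4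
    rw [Real.norm_of_nonneg (by positivity), Real.norm_of_nonneg (by positivity)] at h1
    rw [div_le_iff₀ hc0] at h5
    have h6 : (k n + 1 : ℝ) ≤ c * n := by linarith
    calc (k n + 1 : ℝ) * (1 + Real.logb 2 M) ≤ c * n * (1 + Real.logb 2 M) := by gcongr
      _ = n * (εw / 2) := by rw [hc]; field_simp
  have hP : Tendsto (fun n => P (E1 n) + P (E2 n) + P (E3 n) + P (E4 n)) atTop (𝓝 0) := by
    simpa using ((hW.add hP2).add hP3).add hP4
  rw [tendstoInMeasure_iff_norm]
  intro e he
  refine tendsto_of_tendsto_of_tendsto_of_le_of_le' tendsto_const_nhds hP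
    (Eventually.of_forall fun _ => zero_le) ?_
  filter_upwards [hb.eventually_ge_atTop 1, eventually_gt_atTop 0,
    CSens.eventually_regCoeff_bounds hr0,
    (CSens.tendsto_errorBound hb hδ).eventually_lt_const (show 0 < e ^ 2 by positivity)]
    with n hb1 hn hlam herr
  -- Only monotonicity and subadditivity of `P` are used from here on, so neither the weights nor
  -- the minimizer need be measurable.
  have hsub : P {ω | e ≤ ‖1 / √(n : ℝ) * ‖WithLp.toLp 2 (CSens.samples X n ω - Xhat n ω)‖ - 0‖}
      ≤ P (((E1 n ∪ E2 n) ∪ E3 n) ∪ E4 n) := by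
    refine measure_mono_ae ?_
    filter_upwards [hX𝒳', hXhat n] with ω hω hsol hω1
    change ω ∈ ((E1 n ∪ E2 n) ∪ E3 n) ∪ E4 n
    by_contra hnot
    simp only [Set.mem_union, not_or, hE1, hE2, hE3, hE4, Set.mem_ofPred_eq] at hnot
    obtain ⟨⟨⟨h1, h2⟩, h3⟩, h4⟩ := hnot
    have h1' : CSens.weightDist (CSens.blocks 𝒳 (b n) (k n + 1)) (W n ω)
        (CSens.idealWeight (fun i => CSens.quantize (b n) (CSens.samples X n ω i)) (k n))
          ≤ ENNReal.ofReal (b n * εw) := by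
      have h5 := not_lt.1 h1
      rw [ENNReal.div_le_iff (by exact_mod_cast (by omega : b n ≠ 0)) (by simp),
        ← ENNReal.ofReal_natCast, ← ENNReal.ofReal_mul hεw.le, mul_comm] at h5
      exact h5
    have hfin := hsol.normSq_sub_div_le (fun i => ⟨_, hω _, rfl⟩) hn hd0 hεw (hτ0 n)
      hlam.1 hlam.2 ?_ h1' (not_not.1 h2) (not_lt.1 h3) fun u hu hu' => by
        by_contra hlt
        exact h4 ⟨u, hu, hu', not_le.1 hlt⟩
    · have h6 := hfin.trans_lt herr
      have h7 : e ≤ 1 / √(n : ℝ) * ‖WithLp.toLp 2 (CSens.samples X n ω - Xhat n ω)‖ := by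
        have h8 : e ≤ ‖1 / √(n : ℝ) * ‖WithLp.toLp 2 (CSens.samples X n ω - Xhat n ω)‖ - 0‖ := hω1
        rwa [sub_zero, Real.norm_of_nonneg (by positivity)] at h8
      have h9 := pow_le_pow_left₀ he.le h7 2
      rw [mul_pow, div_pow, Real.sq_sqrt (Nat.cast_nonneg n), one_pow, one_div_mul_eq_div] at h9
      linarith
    · refine le_trans ?_ (hmR n)
      gcongr
      nlinarith [mul_nonneg hδ.le (show 0 ≤ d + 3 * εw by positivity)]
  refine hsub.trans ?_
  refine (measure_union_le _ _).trans (add_le_add_left ?_ _)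
  refine (measure_union_le _ _).trans (add_le_add_left ?_ _)
  exact measure_union_le _ _
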